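/- Let $d\ge 3$. There exist constants $\beta^*,a>0$, depending only on $d$, such that the following holds for every $\beta\ge\beta^*$. For $n\ge 0$ let $\Lambda_n=\{-n,\dots,n\}^d\subset\mathbb{Z}^d$ with its nearest-neighbour edges, and let $\partial\Lambda_n\subset\Lambda_n$ be any set of sites containing every site of $\Lambda_n$ that has a nearest neighbour in $\mathbb{Z}^d\setminus\Lambda_n$ (for instance exactly this interior boundary). Let $\omega=(\omega_{i,j})$ be a random real-valued function on the oriented edges $\vec E(\Lambda_n)$ with $\omega_{i,j}=-\omega_{j,i}$, independent over distinct undirected edges, each $\omega_{i,j}$ having on $[-\pi,\pi)$ the density $$\rho_\beta(t)=\frac{e^{\beta\cos t}}{\int_{-\pi}^{\pi}e^{\beta\cos s}\,ds},$$ and write $\mathbb{E}_\beta$ for the expectation over $\omega$. For fixed $\omega$ let $\langle\cdot\rangle^0_{\omega,\beta,\Lambda_n}$ be the expectation under the probability measure on angles $\theta=(\theta(i))_{i\in\Lambda_n}$, $\theta(i)\in[0,2\pi)$, proportional to $$\exp\Big(\frac{\beta}{2}\sum_{(i,j)\in\vec E(\Lambda_n)}\cos\big(\theta(i)-\theta(j)+\omega_{i,j}\big)\Big)\prod_{i\in\partial\Lambda_n}\delta_0(\theta(i))\prod_{i\in\Lambda_n\setminus\partial\Lambda_n}d\theta(i).$$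 Then $$\liminf_{n\to\infty}\ \mathbb{E}_\beta\Big[\langle\cos\theta(0)\rangle^0_{\omega,\beta,\Lambda_n}\Big]\ \ge\ 1-\sqrt{\frac{a\log\beta}{\beta}}\,.$$ -/

import Mathlib

namespace NishimoriXY

open MeasureTheory

/-- Nearest neighbours in the lattice `ℤ^d`: points at `ℓ¹`-distance one. -/
def Adj {d : ℕ} (i j : Fin d → ℤ) : Prop := ∑ k, |i k - j k| = 1

/-- The box `{-n, …, n}^d`. -/
noncomputable def box (d n : ℕ) : Finset (Fin d → ℤ) :=
  Finset.Icc (fun _ => -(n : ℤ)) (fun _ => (n : ℤ))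

theorem zero_mem_box (d n : ℕ) : (0 : Fin d → ℤ) ∈ box d n := by
  simp only [box, Finset.mem_Icc, Pi.le_def, Pi.zero_apply]
  exact ⟨fun _ => by omega, fun _ => by omega⟩

/-- The origin, as a site of the box. -/
noncomputable def origin (d n : ℕ) : box d n := ⟨0, zero_mem_box d n⟩

open Classical in
/-- The interior boundary of `Λ`: the sites of `Λ` having a lattice neighbour outside `Λ`. -/
noncomputable def innerBoundary {d : ℕ} (Λ : Finset (Fin d → ℤ)) : Finset (Fin d → ℤ) :=
  Λ.filter (fun i => ∃ j, j ∉ Λ ∧ Adj i j)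

/-- `(i, j)` is an edge pointing in a positive coordinate direction. Every undirected
nearest-neighbour edge has exactly one such orientation. -/
def IsPos {d : ℕ} (i j : Fin d → ℤ) : Prop := ∃ k, j = i + Pi.single k 1

/-- The undirected edges of `Λ`, each represented by its positive orientation. -/
abbrev Edge {d : ℕ} (Λ : Finset (Fin d → ℤ)) : Type :=
  {e : Λ × Λ // IsPos (e.1 : Fin d → ℤ) (e.2 : Fin d → ℤ)}

open Classical in
/-- The `1`-form `ω_{i,j} = -ω_{j,i}` on the oriented edges of `Λ` with the prescribed values
on the positively oriented edges (and the irrelevant value `0` on pairs that are no edges). -/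
noncomputable def oneForm {d : ℕ} {Λ : Finset (Fin d → ℤ)} (ω : Edge Λ → ℝ) (i j : Λ) : ℝ :=
  if h : IsPos (i : Fin d → ℤ) (j : Fin d → ℤ) then ω ⟨(i, j), h⟩
  else if h : IsPos (j : Fin d → ℤ) (i : Fin d → ℤ) then -ω ⟨(j, i), h⟩
  else 0

/-- The law on `[-π, π)` with density `exp (u cos ω) / ∫ exp (u cos t) dt`. -/
noncomputable def edgeLaw (u : ℝ) : Measure ℝ :=
  (volume.restrict (Set.Ico (-Real.pi) Real.pi)).withDensity (fun w =>
    ENNReal.ofReal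
      (Real.exp (u * Real.cos w) / ∫ t in (-Real.pi)..Real.pi, Real.exp (u * Real.cos t)))

open Classical in
/-- The law of the quenched disorder: the variables of distinct undirected edges are independent,
each with law `edgeLaw u`. -/
noncomputable def disorderLaw {d : ℕ} (u : ℝ) (Λ : Finset (Fin d → ℤ)) : Measure (Edge Λ → ℝ) :=
  Measure.pi (fun _ => edgeLaw u)

open Classical in
/-- The Gibbs weight `exp ((β / 2) ∑ cos (θ(i) - θ(j) + ω_{i,j}))`, the sum being over all oriented
edges of `Λ`. -/
noncomputable def gibbsWeight {d : ℕ} (β : ℝ) (Λ : Finset (Fin d → ℤ)) (ω : Edge Λ → ℝ)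
    (θ : Λ → ℝ) : ℝ :=
  Real.exp (β / 2 *
    ∑ e ∈ (Finset.univ : Finset (Λ × Λ)).filter
        (fun e => Adj (e.1 : Fin d → ℤ) (e.2 : Fin d → ℤ)),
      Real.cos (θ e.1 - θ e.2 + oneForm ω e.1 e.2))

open Classical in
/-- The reference measure `∏_{i ∈ B} δ_0(θ(i)) ∏_{i ∈ Λ \ B} dθ(i)`, `θ(i) ∈ [0, 2π)`, imposing
`0`-Dirichlet conditions on `B`. -/
noncomputable def refMeasure {d : ℕ} (Λ B : Finset (Fin d → ℤ)) : Measure (Λ → ℝ) :=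
  Measure.pi (fun i : Λ => if (i : Fin d → ℤ) ∈ B then Measure.dirac (0 : ℝ)
    else volume.restrict (Set.Ico 0 (2 * Real.pi)))

/-- The quenched partition function with `0`-Dirichlet conditions on `B`. -/
noncomputable def partitionFn {d : ℕ} (β : ℝ) (Λ B : Finset (Fin d → ℤ)) (ω : Edge Λ → ℝ) : ℝ :=
  ∫ θ, gibbsWeight β Λ ω θ ∂(refMeasure Λ B)

/-- The quenched Gibbs expectation of `f` with `0`-Dirichlet conditions on `B`. -/
noncomputable def gibbsExp {d : ℕ} (β : ℝ) (Λ B : Finset (Fin d → ℤ)) (ω : Edge Λ → ℝ)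
    (f : (Λ → ℝ) → ℝ) : ℝ :=
  (∫ θ, f θ * gibbsWeight β Λ ω θ ∂(refMeasure Λ B)) / partitionFn β Λ B ω

/-- The averaged quenched expectation of `f` on the Nishimori line, where the parameter of the
disorder equals the inverse temperature. -/
noncomputable def nishimoriExp {d : ℕ} (β : ℝ) (Λ B : Finset (Fin d → ℤ))
    (f : (Λ → ℝ) → ℝ) : ℝ :=
  ∫ ω, gibbsExp β Λ B ω f ∂(disorderLaw β Λ)

end NishimoriXY

namespace NishimoriXY

open MeasureTheory

/-! ### Periodic functions and shifts -/

/-! The proof combines gauge invariance with Cauchy–Schwarz. A gauge transformation shifts `ω` by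
`grad φ`, with `φ = 0` on `B`, and is undone by translating the spins. Since the disorder parameter
equals the inverse temperature, the disorder density is the Gibbs weight at `θ = 0` up to a constant
(`gibbsWeight_zero`). Averaging over `φ` therefore turns disorder averages of gauge equivariant
functions into averages over the joint law of disorder and spins, of density proportional to
`gibbsWeight` (`integral_disorderLaw_gauge`). With `c`, `s` the quenched means of cosine and sine at
the origin, the magnetisation `G` becomes the joint average of `c² + s²`. If `X + iY` rotates by
`φ(0)` under gauge transformations and `X` has mean one, then the joint average of `Xc - Ys` is one,
and Cauchy–Schwarz gives `1 ≤ E[X² + Y²] * G` (`one_le_second_moment_mul_nishimoriExp`).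

The observable is an average over random paths from the origin to the boundary of `m⁻¹ ^ length *
exp (i ∑ ω)`, the sum being along the path and `m = edgeMean β`. By independence its second moment
is the average of `(m⁻²) ^ (number of common edges)` over two independent paths
(`one_le_average_mul_nishimoriExp`), and `1 - m = O(1/β)` by Laplace-type estimates
(`one_sub_edgeMean_le`).

It remains to find paths with few common edges. The third coordinate serves as time and the first
two follow independent unpredictable walks. Given the past up to time `t`, such a walk sits at a
prescribed site at time `r` with probability of order `(r - t) ^ (-γ)`, `γ = log₂ (3/2) > 1/2`. For
two coordinates the squares are summable, which is where `3 ≤ d` matters, so the number of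
collisions has exponential moments (`sum_pow_card_collisions_le`). The outcome is `G ≥ 1 - O(1/β)`
uniformly in the box, stronger than the stated bound. -/

theorem measurePreserving_toIocMod_add (a c : ℝ) :
    MeasurePreserving (fun x => toIocMod Real.two_pi_pos a (x + c))
      (volume.restrict (Set.Ico a (a + 2 * Real.pi)))
      (volume.restrict (Set.Ico a (a + 2 * Real.pi))) := by
  have : Fact (0 < 2 * Real.pi) := ⟨Real.two_pi_pos⟩
  have hI : (volume : Measure ℝ).restrict (Set.Ico a (a + 2 * Real.pi)) =
      volume.restrict (Set.Ioc a (a + 2 * Real.pi)) := Measure.restrict_congr_set Ico_ae_eq_Ioc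
  rw [hI]
  -- The map factors through the circle, where translations preserve Haar measure.
  have h1 := AddCircle.measurePreserving_mk (2 * Real.pi) a
  have h2 := measurePreserving_add_right (volume : Measure (AddCircle (2 * Real.pi)))
    (c : AddCircle (2 * Real.pi))
  have h3 := AddCircle.measurePreserving_equivIoc (2 * Real.pi) (a := a)
  have h4 : MeasurePreserving (Subtype.val : Set.Ioc a (a + 2 * Real.pi) → ℝ)
      (Measure.comap Subtype.val volume) (volume.restrict (Set.Ioc a (a + 2 * Real.pi))) :=
    ⟨measurable_subtype_coe, map_comap_subtype_coe measurableSet_Ioc _⟩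
  exact h4.comp (h3.comp (h2.comp h1))

/-- `2π`-periodicity in each coordinate. -/
def IsPeriodic {ι : Type*} (F : (ι → ℝ) → ℝ) : Prop :=
  ∀ (x : ι → ℝ) (k : ι → ℤ), F (fun i => x i + k i * (2 * Real.pi)) = F x

theorem IsPeriodic.apply_toIocMod {ι : Type*} {F : (ι → ℝ) → ℝ} (hF : IsPeriodic F) (a : ℝ)
    (x : ι → ℝ) : F (fun i => toIocMod Real.two_pi_pos a (x i)) = F x := by
  rw [← hF (fun i => toIocMod Real.two_pi_pos a (x i))
    (fun i => toIocDiv Real.two_pi_pos a (x i))]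
  congr 1
  funext i
  have := toIocMod_add_toIocDiv_zsmul Real.two_pi_pos a (x i)
  rwa [zsmul_eq_mul] at this

-- Translating and reducing modulo `2π` preserves Lebesgue measure on a period, and a periodic `F`
-- does not see the reduction. Coordinates carrying any other measure, such as a Dirac mass, must
-- not be shifted. The lemma serves both for the disorder and for the spins with Dirichlet
-- conditions.
open Classical in
theorem integral_pi_shift {ι : Type*} [Fintype ι] (μ : ι → Measure ℝ) [∀ i, IsFiniteMeasure (μ i)]
    (a : ℝ) (c : ι → ℝ)
    (h : ∀ i, c i = 0 ∨ μ i = volume.restrict (Set.Ico a (a + 2 * Real.pi)))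
    {F : (ι → ℝ) → ℝ} (hF : IsPeriodic F) (hm : Measurable F) :
    ∫ x, F (fun i => x i + c i) ∂(Measure.pi μ) = ∫ x, F x ∂(Measure.pi μ) := by
  let f : ι → ℝ → ℝ := fun i x => if c i = 0 then x else toIocMod Real.two_pi_pos a (x + c i)
  have hf : ∀ i, MeasurePreserving (f i) (μ i) (μ i) := by
    intro i
    by_cases hc : c i = 0
    · simp only [f, hc, if_true]
      exact MeasurePreserving.id _
    · simp only [f, hc, if_false]
      rw [(h i).resolve_left hc]
      exact measurePreserving_toIocMod_add a (c i)
  have hpi := measurePreserving_pi μ μ hf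
  rw [← hpi.map_eq, integral_map hpi.measurable.aemeasurable hm.aestronglyMeasurable, hpi.map_eq]
  refine integral_congr_ae (Filter.Eventually.of_forall fun x => ?_)
  change F (fun i => x i + c i) = F (fun i => f i (x i))
  rw [← hF.apply_toIocMod a, ← hF.apply_toIocMod a (fun i => f i (x i))]
  congr 1
  funext i
  by_cases hc : c i = 0
  · simp [f, hc]
  · simp only [f, hc, if_false]
    exact ((toIocMod_eq_toIocMod Real.two_pi_pos).2
      ⟨-toIocDiv Real.two_pi_pos a (x i + c i), toIocMod_sub_self _ _ _⟩)

/-- It suffices to compare measurable boxes, where both sides are integrals of a product of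
functions of one coordinate each. -/
theorem pi_withDensity_ofReal {ι : Type*} [Fintype ι] (μ : Measure ℝ) [IsFiniteMeasure μ]
    {f : ℝ → ℝ} (h0 : ∀ x, 0 ≤ f x) (hi : Integrable f μ)
    [SigmaFinite (μ.withDensity fun x => ENNReal.ofReal (f x))] :
    Measure.pi (fun _ : ι => μ.withDensity fun x => ENNReal.ofReal (f x)) =
      (Measure.pi (fun _ : ι => μ)).withDensity (fun x => ENNReal.ofReal (∏ i, f (x i))) := by
  refine Measure.pi_eq fun s hs => ?_
  have key : ∀ (t : Set ℝ), MeasurableSet t →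
      (μ.withDensity fun x => ENNReal.ofReal (f x)) t =
        ENNReal.ofReal (∫ x, t.indicator f x ∂μ) := by
    intro t ht
    rw [withDensity_apply _ ht, ← ofReal_integral_eq_lintegral_ofReal hi.restrict
      (Filter.Eventually.of_forall h0), integral_indicator ht]
  rw [withDensity_apply _ (MeasurableSet.univ_pi hs)]
  simp_rw [key _ (hs _)]
  rw [← ENNReal.ofReal_prod_of_nonneg
    (fun i _ => integral_nonneg fun x => Set.indicator_nonneg (fun y _ => h0 y) x)]
  rw [← integral_fintype_prod_eq_prod (𝕜 := ℝ) (fun i x => (s i).indicator f x)]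
  have hind : ∀ x : ι → ℝ, ∏ i, (s i).indicator f (x i) =
      (Set.univ.pi s).indicator (fun x => ∏ i, f (x i)) x := by
    intro x
    by_cases hx : x ∈ Set.univ.pi s
    · rw [Set.indicator_of_mem hx]
      exact Finset.prod_congr rfl fun i _ => Set.indicator_of_mem (hx i (Set.mem_univ i)) _
    · rw [Set.indicator_of_notMem hx]
      simp only [Set.mem_pi, Set.mem_univ, true_implies, not_forall] at hx
      obtain ⟨i, hi⟩ := hx
      exact Finset.prod_eq_zero (Finset.mem_univ i) (Set.indicator_of_notMem hi _)
  simp_rw [hind]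
  rw [integral_indicator (MeasurableSet.univ_pi hs)]
  rw [ofReal_integral_eq_lintegral_ofReal]
  · exact (Integrable.fintype_prod (𝕜 := ℝ) (f := fun (_ : ι) x => f x) fun _ => hi).restrict
  · exact Filter.Eventually.of_forall fun x => Finset.prod_nonneg fun i _ => h0 _

/-! ### The law of a single edge variable -/

/-- The normalisation of the law of an edge variable. -/
noncomputable def edgeNorm (u : ℝ) : ℝ := ∫ t in (-Real.pi)..Real.pi, Real.exp (u * Real.cos t)

theorem edgeNorm_pos (u : ℝ) : 0 < edgeNorm u :=
  intervalIntegral.intervalIntegral_pos_of_pos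
    (Continuous.intervalIntegrable (by fun_prop) _ _) (fun x => Real.exp_pos _)
    (by linarith [Real.pi_pos])

/-- The density of the law of an edge variable. -/
noncomputable def edgeDensity (u w : ℝ) : ℝ := Real.exp (u * Real.cos w) / edgeNorm u

/-- Lebesgue measure on `[-π, π)`. -/
noncomputable abbrev circleMeasure : Measure ℝ :=
  volume.restrict (Set.Ico (-Real.pi) Real.pi)

theorem edgeDensity_nonneg (u w : ℝ) : 0 ≤ edgeDensity u w :=
  div_nonneg (Real.exp_pos _).le (edgeNorm_pos u).le

theorem continuous_edgeDensity (u : ℝ) : Continuous (edgeDensity u) := by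
  unfold edgeDensity; fun_prop

theorem integrable_circleMeasure {f : ℝ → ℝ} (hf : Continuous f) :
    Integrable f circleMeasure :=
  (hf.continuousOn.integrableOn_Icc (a := -Real.pi) (b := Real.pi)).mono_set
    Set.Ico_subset_Icc_self

theorem edgeLaw_eq (u : ℝ) :
    edgeLaw u = circleMeasure.withDensity (fun w => ENNReal.ofReal (edgeDensity u w)) := rfl

theorem integral_circleMeasure (f : ℝ → ℝ) :
    ∫ x, f x ∂circleMeasure = ∫ x in (-Real.pi)..Real.pi, f x := by
  rw [intervalIntegral.integral_of_le (by linarith [Real.pi_pos]), integral_Ico_eq_integral_Ioc]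

theorem integral_edgeDensity (u : ℝ) : ∫ w, edgeDensity u w ∂circleMeasure = 1 := by
  unfold edgeDensity
  rw [integral_div, integral_circleMeasure]
  exact div_self (edgeNorm_pos u).ne'

instance (u : ℝ) : IsProbabilityMeasure (edgeLaw u) := by
  refine ⟨?_⟩
  rw [edgeLaw_eq, withDensity_apply _ MeasurableSet.univ, Measure.restrict_univ,
    ← ofReal_integral_eq_lintegral_ofReal (integrable_circleMeasure (continuous_edgeDensity u))
      (Filter.Eventually.of_forall (edgeDensity_nonneg u)), integral_edgeDensity,
    ENNReal.ofReal_one]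

instance {d : ℕ} (u : ℝ) (Λ : Finset (Fin d → ℤ)) : IsProbabilityMeasure (disorderLaw u Λ) := by
  unfold disorderLaw; infer_instance

theorem integral_edgeLaw (u : ℝ) (f : ℝ → ℝ) :
    ∫ w, f w ∂(edgeLaw u) = ∫ w, edgeDensity u w * f w ∂circleMeasure := by
  rw [edgeLaw_eq, integral_withDensity_eq_integral_toReal_smul
    (continuous_edgeDensity u).measurable.ennreal_ofReal (by simp)]
  simp [ENNReal.toReal_ofReal (edgeDensity_nonneg u _)]

open Classical in
noncomputable instance {d : ℕ} (Λ : Finset (Fin d → ℤ)) : Fintype (Edge Λ) := inferInstance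

theorem integral_disorderLaw {d : ℕ} (u : ℝ) (Λ : Finset (Fin d → ℤ)) (F : (Edge Λ → ℝ) → ℝ) :
    ∫ ω, F ω ∂(disorderLaw u Λ) =
      ∫ ω, (∏ e, edgeDensity u (ω e)) * F ω ∂(Measure.pi fun _ : Edge Λ => circleMeasure) := by
  have h0 : ∀ ω : Edge Λ → ℝ, 0 ≤ ∏ e, edgeDensity u (ω e) :=
    fun ω => Finset.prod_nonneg fun e _ => edgeDensity_nonneg u _
  have hinst : SigmaFinite (circleMeasure.withDensity
      fun w => ENNReal.ofReal (edgeDensity u w)) := by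
    rw [← edgeLaw_eq]; infer_instance
  have hc : Continuous (fun ω : Edge Λ → ℝ => ∏ e, edgeDensity u (ω e)) :=
    continuous_finsetProd _ fun e _ => (continuous_edgeDensity u).comp (continuous_apply e)
  have hpi : disorderLaw u Λ = (Measure.pi fun _ : Edge Λ => circleMeasure).withDensity
      (fun ω => ENNReal.ofReal (∏ e, edgeDensity u (ω e))) :=
    pi_withDensity_ofReal (ι := Edge Λ) circleMeasure (edgeDensity_nonneg u)
      (integrable_circleMeasure (continuous_edgeDensity u))
  rw [hpi, integral_withDensity_eq_integral_toReal_smul hc.measurable.ennreal_ofReal (by simp)]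
  simp_rw [ENNReal.toReal_ofReal (h0 _), smul_eq_mul]


/-! ### The Gibbs weight as a sum over undirected edges -/

theorem IsPos.not_symm {d : ℕ} {i j : Fin d → ℤ} (h : IsPos i j) : ¬ IsPos j i := by
  rintro ⟨l, hl⟩
  obtain ⟨k, hk⟩ := h
  have h1 : (Pi.single k 1 : Fin d → ℤ) + Pi.single l 1 = 0 := by
    have : i + (Pi.single k 1 + Pi.single l 1) = i + 0 := by
      rw [← add_assoc, ← hk, ← hl, add_zero]
    exact add_left_cancel this
  have h2 := congrFun h1 k
  have h3 : (0 : ℤ) ≤ (Pi.single l 1 : Fin d → ℤ) k := by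
    rw [Pi.single_apply]; split_ifs <;> simp
  simp only [Pi.add_apply, Pi.single_eq_same, Pi.zero_apply] at h2
  omega

theorem adj_iff {d : ℕ} {i j : Fin d → ℤ} : Adj i j ↔ IsPos i j ∨ IsPos j i := by
  constructor
  · intro h
    unfold Adj at h
    obtain ⟨k, -, hk⟩ : ∃ k ∈ Finset.univ, |i k - j k| ≠ 0 := by
      apply Finset.exists_ne_zero_of_sum_ne_zero
      omega
    have hsplit := Finset.add_sum_erase Finset.univ (fun k => |i k - j k|) (Finset.mem_univ k)
    have hk0 := abs_nonneg (i k - j k)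
    have hr : 0 ≤ ∑ l ∈ Finset.univ.erase k, |i l - j l| :=
      Finset.sum_nonneg fun _ _ => abs_nonneg _
    have hk1 : |i k - j k| = 1 := by omega
    have hr0 : ∑ l ∈ Finset.univ.erase k, |i l - j l| = 0 := by omega
    rw [Finset.sum_eq_zero_iff_of_nonneg fun _ _ => abs_nonneg _] at hr0
    have hne : ∀ l, l ≠ k → i l = j l := fun l hl => by
      have := hr0 l (Finset.mem_erase.2 ⟨hl, Finset.mem_univ l⟩)
      have := abs_eq_zero.1 this
      omega
    rcases (abs_eq zero_le_one).1 hk1 with h1 | h1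
    · refine Or.inr ⟨k, funext fun l => ?_⟩
      rcases eq_or_ne l k with rfl | hl
      · simp; omega
      · simp [hl, hne l hl]
    · refine Or.inl ⟨k, funext fun l => ?_⟩
      rcases eq_or_ne l k with rfl | hl
      · simp; omega
      · simp [hl, hne l hl]
  · have key : ∀ (x : Fin d → ℤ) (k : Fin d), Adj x (x + Pi.single k 1) := by
      intro x k
      unfold Adj
      rw [Finset.sum_eq_single k]
      · simp
      · intro l _ hl
        simp [hl]
      · simp
    rintro (⟨k, rfl⟩ | ⟨k, rfl⟩)
    · exact key i k
    · have := key j k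
      unfold Adj at this ⊢
      exact (Finset.sum_congr rfl fun l _ => abs_sub_comm _ _).trans this

/-- The gradient of a function on the sites, as a function on the positively oriented edges. -/
def grad {d : ℕ} {Λ : Finset (Fin d → ℤ)} (θ : Λ → ℝ) (e : Edge Λ) : ℝ := θ e.1.1 - θ e.1.2

/-- The two orientations of an edge contribute equally because cosine is even; this absorbs the
factor `1 / 2`. -/
theorem gibbsWeight_eq {d : ℕ} (β : ℝ) (Λ : Finset (Fin d → ℤ)) (ω : Edge Λ → ℝ) (θ : Λ → ℝ) :
    gibbsWeight β Λ ω θ = Real.exp (β * ∑ e : Edge Λ, Real.cos (ω e + grad θ e)) := by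
  classical
  unfold gibbsWeight
  congr 1
  let f : Λ × Λ → ℝ := fun e => Real.cos (θ e.1 - θ e.2 + oneForm ω e.1 e.2)
  have hpos : ∑ e ∈ Finset.univ.filter
      (fun e : Λ × Λ => IsPos (e.1 : Fin d → ℤ) (e.2 : Fin d → ℤ)), f e =
      ∑ e : Edge Λ, Real.cos (ω e + grad θ e) := by
    rw [Finset.sum_subtype (p := fun e : Λ × Λ => IsPos (e.1 : Fin d → ℤ) (e.2 : Fin d → ℤ))
      _ (by simp)]
    refine Finset.sum_congr (by congr!) fun e _ => ?_
    simp only [f, grad, oneForm, e.2, dif_pos]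
    rw [add_comm]
  have hneg : ∑ e ∈ Finset.univ.filter
      (fun e : Λ × Λ => IsPos (e.2 : Fin d → ℤ) (e.1 : Fin d → ℤ)), f e =
      ∑ e : Edge Λ, Real.cos (ω e + grad θ e) := by
    rw [← hpos]
    refine Finset.sum_nbij' Prod.swap Prod.swap (by simp) (by simp) (by simp) (by simp) ?_
    intro e he
    have h1 : IsPos (e.2 : Fin d → ℤ) (e.1 : Fin d → ℤ) := by simpa using he
    simp only [f, oneForm, h1.not_symm, h1, dif_pos, Prod.fst_swap, Prod.snd_swap,
      dif_neg, not_false_eq_true]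
    rw [← Real.cos_neg]
    congr 1
    ring
  have hsplit : ∑ e ∈ Finset.univ.filter
      (fun e : Λ × Λ => Adj (e.1 : Fin d → ℤ) (e.2 : Fin d → ℤ)), f e =
      2 * ∑ e : Edge Λ, Real.cos (ω e + grad θ e) := by
    simp_rw [adj_iff]
    rw [Finset.filter_or, Finset.sum_union, hpos, hneg, two_mul]
    rw [Finset.disjoint_filter]
    exact fun e _ h => h.not_symm
  change β / 2 * ∑ e ∈ Finset.univ.filter
      (fun e : Λ × Λ => Adj (e.1 : Fin d → ℤ) (e.2 : Fin d → ℤ)), f e = _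
  rw [hsplit]
  ring

variable {d : ℕ} {Λ : Finset (Fin d → ℤ)}

theorem gibbsWeight_pos (β : ℝ) (ω : Edge Λ → ℝ) (θ : Λ → ℝ) : 0 < gibbsWeight β Λ ω θ :=
  Real.exp_pos _

theorem gibbsWeight_add_grad (β : ℝ) (ω : Edge Λ → ℝ) (φ θ : Λ → ℝ) :
    gibbsWeight β Λ (fun e => ω e + grad φ e) θ = gibbsWeight β Λ ω (fun i => θ i + φ i) := by
  simp only [gibbsWeight_eq, grad]
  congr 2
  refine Finset.sum_congr rfl fun e _ => ?_
  congr 1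
  ring

theorem gibbsWeight_periodic_left (β : ℝ) (θ : Λ → ℝ) :
    IsPeriodic fun ω => gibbsWeight β Λ ω θ := by
  intro ω k
  simp only [gibbsWeight_eq]
  congr 2
  refine Finset.sum_congr rfl fun e _ => ?_
  rw [← Real.cos_add_int_mul_two_pi (ω e + grad θ e) (k e)]
  congr 1
  ring

theorem gibbsWeight_periodic_right (β : ℝ) (ω : Edge Λ → ℝ) :
    IsPeriodic fun θ => gibbsWeight β Λ ω θ := by
  intro θ k
  simp only [gibbsWeight_eq]
  congr 2
  refine Finset.sum_congr rfl fun e _ => ?_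
  rw [← Real.cos_add_int_mul_two_pi (ω e + grad θ e) (k e.1.1 - k e.1.2)]
  congr 1
  simp only [grad]
  push_cast
  ring

theorem continuous_gibbsWeight (β : ℝ) :
    Continuous fun p : (Edge Λ → ℝ) × (Λ → ℝ) => gibbsWeight β Λ p.1 p.2 := by
  simp only [gibbsWeight_eq, grad]
  fun_prop

theorem continuous_gibbsWeight_right (β : ℝ) (ω : Edge Λ → ℝ) :
    Continuous fun θ => gibbsWeight β Λ ω θ := by
  simp only [gibbsWeight_eq, grad]
  fun_prop

theorem gibbsWeight_le (β : ℝ) (ω : Edge Λ → ℝ) (θ : Λ → ℝ) :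
    gibbsWeight β Λ ω θ ≤ Real.exp (|β| * Fintype.card (Edge Λ)) := by
  rw [gibbsWeight_eq]
  apply Real.exp_le_exp.2
  refine (le_abs_self _).trans ?_
  rw [abs_mul]
  refine mul_le_mul_of_nonneg_left ?_ (abs_nonneg β)
  refine (Finset.abs_sum_le_sum_abs _ _).trans ?_
  refine (Finset.sum_le_card_nsmul _ _ 1 fun e _ => Real.abs_cos_le_one _).trans ?_
  simp

/-- The Nishimori condition enters here: the disorder density and the Gibbs weight share the same
`β`. -/
theorem gibbsWeight_zero (β : ℝ) (ω : Edge Λ → ℝ) :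
    ∏ e, edgeDensity β (ω e) =
      ((edgeNorm β) ^ Fintype.card (Edge Λ))⁻¹ * gibbsWeight β Λ ω 0 := by
  rw [gibbsWeight_eq]
  simp only [edgeDensity, grad, Pi.zero_apply, sub_zero, add_zero]
  rw [Finset.prod_div_distrib, ← Real.exp_sum, Finset.mul_sum]
  simp [div_eq_inv_mul]

/-! ### The reference measure on the spins -/

instance (B : Finset (Fin d → ℤ)) : IsFiniteMeasure (refMeasure Λ B) := by
  classical
  have (i : Λ) : IsFiniteMeasure (if (i : Fin d → ℤ) ∈ B then Measure.dirac (0 : ℝ)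
      else volume.restrict (Set.Ico 0 (2 * Real.pi))) := by
    split_ifs <;> infer_instance
  unfold refMeasure
  convert (inferInstance : IsFiniteMeasure (Measure.pi (fun i : Λ =>
    if (i : Fin d → ℤ) ∈ B then Measure.dirac (0 : ℝ)
      else volume.restrict (Set.Ico 0 (2 * Real.pi)))))

theorem refMeasure_ne_zero (B : Finset (Fin d → ℤ)) : refMeasure Λ B ≠ 0 := by
  classical
  have (i : Λ) : IsFiniteMeasure (if (i : Fin d → ℤ) ∈ B then Measure.dirac (0 : ℝ)
      else volume.restrict (Set.Ico 0 (2 * Real.pi))) := by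
    split_ifs <;> infer_instance
  rw [← Measure.measure_univ_ne_zero]
  unfold refMeasure
  rw [Measure.pi_univ, Finset.prod_ne_zero_iff]
  intro i _
  split_ifs
  · simp
  · simp [Real.pi_pos]

theorem ae_refMeasure_eq_zero (B : Finset (Fin d → ℤ)) :
    ∀ᵐ θ ∂(refMeasure Λ B), ∀ i : Λ, (i : Fin d → ℤ) ∈ B → θ i = 0 := by
  classical
  have (i : Λ) : IsFiniteMeasure (if (i : Fin d → ℤ) ∈ B then Measure.dirac (0 : ℝ)
      else volume.restrict (Set.Ico 0 (2 * Real.pi))) := by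
    split_ifs <;> infer_instance
  rw [ae_all_iff]
  intro i
  by_cases hi : (i : Fin d → ℤ) ∈ B
  · simp only [hi, true_implies]
    refine (Measure.quasiMeasurePreserving_eval (μ := fun i : Λ =>
      if (i : Fin d → ℤ) ∈ B then Measure.dirac (0 : ℝ)
        else volume.restrict (Set.Ico 0 (2 * Real.pi))) i).ae (p := fun x => x = 0) ?_
    simp [hi]
  · simp [hi]

theorem integral_refMeasure_shift (B : Finset (Fin d → ℤ)) {φ : Λ → ℝ}
    (hφ : ∀ i : Λ, (i : Fin d → ℤ) ∈ B → φ i = 0) {F : (Λ → ℝ) → ℝ} (hF : IsPeriodic F)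
    (hm : Measurable F) :
    ∫ θ, F (fun i => θ i + φ i) ∂(refMeasure Λ B) = ∫ θ, F θ ∂(refMeasure Λ B) := by
  classical
  have (i : Λ) : IsFiniteMeasure (if (i : Fin d → ℤ) ∈ B then Measure.dirac (0 : ℝ)
      else volume.restrict (Set.Ico 0 (2 * Real.pi))) := by
    split_ifs <;> infer_instance
  refine integral_pi_shift _ 0 φ (fun i => ?_) hF hm
  by_cases hi : (i : Fin d → ℤ) ∈ B
  · exact Or.inl (hφ i hi)
  · exact Or.inr (by simp [hi])

/-! ### Unnormalised Gibbs expectations -/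

/-- The Gibbs expectation before division by the partition function. -/
noncomputable def rawExp (β : ℝ) (Λ B : Finset (Fin d → ℤ)) (f : (Λ → ℝ) → ℝ)
    (ω : Edge Λ → ℝ) : ℝ :=
  ∫ θ, f θ * gibbsWeight β Λ ω θ ∂(refMeasure Λ B)

theorem integrable_mul_gibbsWeight (β : ℝ) (B : Finset (Fin d → ℤ)) {f : (Λ → ℝ) → ℝ}
    (hf : Continuous f) (hb : ∀ θ, |f θ| ≤ 1) (ω : Edge Λ → ℝ) :
    Integrable (fun θ => f θ * gibbsWeight β Λ ω θ) (refMeasure Λ B) := by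
  have hc : Continuous fun θ => f θ * gibbsWeight β Λ ω θ :=
    hf.mul (continuous_gibbsWeight_right β ω)
  refine Integrable.of_bound hc.aestronglyMeasurable
    (Real.exp (|β| * Fintype.card (Edge Λ))) (Filter.Eventually.of_forall fun θ => ?_)
  rw [Real.norm_eq_abs, abs_mul, abs_of_pos (gibbsWeight_pos β ω θ), ← one_mul (Real.exp _)]
  exact mul_le_mul (hb θ) (gibbsWeight_le β ω θ) (gibbsWeight_pos β ω θ).le zero_le_one

theorem measurable_rawExp (β : ℝ) (B : Finset (Fin d → ℤ)) {f : (Λ → ℝ) → ℝ}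
    (hf : Continuous f) : Measurable (rawExp β Λ B f) := by
  have hc : Continuous fun p : (Edge Λ → ℝ) × (Λ → ℝ) => f p.2 * gibbsWeight β Λ p.1 p.2 :=
    (hf.comp continuous_snd).mul (continuous_gibbsWeight β)
  exact (hc.stronglyMeasurable.integral_prod_right' (ν := refMeasure Λ B)).measurable

theorem partitionFn_eq (β : ℝ) (B : Finset (Fin d → ℤ)) (ω : Edge Λ → ℝ) :
    partitionFn β Λ B ω = rawExp β Λ B (fun _ => 1) ω := by
  simp [partitionFn, rawExp]

theorem partitionFn_pos (β : ℝ) (B : Finset (Fin d → ℤ)) (ω : Edge Λ → ℝ) :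
    0 < partitionFn β Λ B ω := by
  have hi := integrable_mul_gibbsWeight β B (Λ := Λ) (f := fun _ => 1) continuous_const
    (by simp) ω
  simp only [one_mul] at hi
  rw [partitionFn, integral_pos_iff_support_of_nonneg (fun θ => (gibbsWeight_pos β ω θ).le) hi]
  have : Function.support (fun θ => gibbsWeight β Λ ω θ) = Set.univ :=
    Set.eq_univ_of_forall fun θ => (gibbsWeight_pos β ω θ).ne'
  rw [this]
  exact (Measure.measure_univ_pos).2 (refMeasure_ne_zero B)

theorem abs_rawExp_le (β : ℝ) (B : Finset (Fin d → ℤ)) {f : (Λ → ℝ) → ℝ}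
    (hf : Continuous f) (hb : ∀ θ, |f θ| ≤ 1) (ω : Edge Λ → ℝ) :
    |rawExp β Λ B f ω| ≤ partitionFn β Λ B ω := by
  have h1 := integrable_mul_gibbsWeight β B (Λ := Λ) (f := fun _ => 1) continuous_const
    (by simp) ω
  simp only [one_mul] at h1
  refine (abs_integral_le_integral_abs).trans (integral_mono
    (integrable_mul_gibbsWeight β B hf hb ω).abs h1 fun θ => ?_)
  simp only [abs_mul, abs_of_pos (gibbsWeight_pos β ω θ)]
  exact mul_le_of_le_one_left (gibbsWeight_pos β ω θ).le (hb θ)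

theorem abs_gibbsExp_le (β : ℝ) (B : Finset (Fin d → ℤ)) {f : (Λ → ℝ) → ℝ}
    (hf : Continuous f) (hb : ∀ θ, |f θ| ≤ 1) (ω : Edge Λ → ℝ) :
    |gibbsExp β Λ B ω f| ≤ 1 := by
  unfold gibbsExp
  rw [abs_div, abs_of_pos (partitionFn_pos β B ω)]
  exact (div_le_one (partitionFn_pos β B ω)).2 (abs_rawExp_le β B hf hb ω)

theorem measurable_gibbsExp (β : ℝ) (B : Finset (Fin d → ℤ)) {f : (Λ → ℝ) → ℝ}
    (hf : Continuous f) : Measurable fun ω => gibbsExp β Λ B ω f := by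
  have h1 := measurable_rawExp β B hf (Λ := Λ)
  have h2 := measurable_rawExp β B (Λ := Λ) (f := fun _ => 1) continuous_const
  have : (fun ω => gibbsExp β Λ B ω f) =
      fun ω => rawExp β Λ B f ω / rawExp β Λ B (fun _ => 1) ω := by
    funext ω
    rw [← partitionFn_eq]
    rfl
  rw [this]
  exact h1.div h2

theorem gibbsExp_periodic (β : ℝ) (B : Finset (Fin d → ℤ)) (f : (Λ → ℝ) → ℝ) :
    IsPeriodic fun ω => gibbsExp β Λ B ω f := by
  intro ω k
  have h : ∀ θ, gibbsWeight β Λ (fun i => ω i + k i * (2 * Real.pi)) θ = gibbsWeight β Λ ω θ :=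
    fun θ => gibbsWeight_periodic_left β θ ω k
  simp only [gibbsExp, partitionFn, h]

/-- A gauge transformation of the disorder is the translation `θ ↦ θ + φ` of the spins, which the
reference measure tolerates because `φ` vanishes on `B`. -/
theorem rawExp_add_grad (β : ℝ) (B : Finset (Fin d → ℤ)) {φ : Λ → ℝ}
    (hφ : ∀ i : Λ, (i : Fin d → ℤ) ∈ B → φ i = 0) {f : (Λ → ℝ) → ℝ} (hf : Continuous f)
    (hp : IsPeriodic f) (ω : Edge Λ → ℝ) :
    rawExp β Λ B (fun θ => f (fun i => θ i + φ i)) (fun e => ω e + grad φ e) =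
      rawExp β Λ B f ω := by
  have hc : Continuous fun θ => f θ * gibbsWeight β Λ ω θ :=
    hf.mul (continuous_gibbsWeight_right β ω)
  unfold rawExp
  rw [← integral_refMeasure_shift B hφ (F := fun θ => f θ * gibbsWeight β Λ ω θ) ?_
    hc.measurable]
  · simp_rw [gibbsWeight_add_grad]
  · intro θ k
    have h1 := hp θ k
    have h2 := gibbsWeight_periodic_right β ω θ k
    simp only at h2 ⊢
    rw [h1, h2]

theorem partitionFn_add_grad (β : ℝ) (B : Finset (Fin d → ℤ)) {φ : Λ → ℝ}
    (hφ : ∀ i : Λ, (i : Fin d → ℤ) ∈ B → φ i = 0) (ω : Edge Λ → ℝ) :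
    partitionFn β Λ B (fun e => ω e + grad φ e) = partitionFn β Λ B ω := by
  rw [partitionFn_eq, partitionFn_eq]
  exact rawExp_add_grad β B hφ (f := fun _ => 1) continuous_const (fun _ _ => rfl) ω

theorem gibbsExp_cos_add_grad (β : ℝ) (B : Finset (Fin d → ℤ)) (o : Λ) {φ : Λ → ℝ}
    (hφ : ∀ i : Λ, (i : Fin d → ℤ) ∈ B → φ i = 0) (ω : Edge Λ → ℝ) :
    gibbsExp β Λ B (fun e => ω e + grad φ e) (fun θ => Real.cos (θ o)) =
      gibbsExp β Λ B ω (fun θ => Real.cos (θ o)) * Real.cos (φ o) +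
      gibbsExp β Λ B ω (fun θ => Real.sin (θ o)) * Real.sin (φ o) := by
  have h := rawExp_add_grad β B hφ (f := fun θ => Real.cos (θ o - φ o)) (by fun_prop)
    (fun θ k => by
      simp only
      rw [← Real.cos_add_int_mul_two_pi (θ o - φ o) (k o)]
      congr 1
      ring) ω
  simp only [add_sub_cancel_right] at h
  have h2 : rawExp β Λ B (fun θ => Real.cos (θ o - φ o)) ω =
      rawExp β Λ B (fun θ => Real.cos (θ o)) ω * Real.cos (φ o) +
      rawExp β Λ B (fun θ => Real.sin (θ o)) ω * Real.sin (φ o) := by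
    have hc := integrable_mul_gibbsWeight β B (Λ := Λ) (f := fun θ => Real.cos (θ o))
      (by fun_prop) (fun θ => Real.abs_cos_le_one _) ω
    have hs := integrable_mul_gibbsWeight β B (Λ := Λ) (f := fun θ => Real.sin (θ o))
      (by fun_prop) (fun θ => Real.abs_sin_le_one _) ω
    unfold rawExp
    rw [← integral_mul_const, ← integral_mul_const, ← integral_add (hc.mul_const _)
      (hs.mul_const _)]
    refine integral_congr_ae (Filter.Eventually.of_forall fun θ => ?_)
    simp only [Real.cos_sub]
    ring
  change rawExp β Λ B _ _ / _ = rawExp β Λ B _ _ / _ * _ + rawExp β Λ B _ _ / _ * _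
  rw [h, h2, partitionFn_add_grad β B hφ]
  ring


/-! ### The Nishimori identity -/

theorem continuous_gibbsWeight_left (β : ℝ) (θ : Λ → ℝ) :
    Continuous fun ω => gibbsWeight β Λ ω θ := by
  simp only [gibbsWeight_eq, grad]
  fun_prop

theorem integral_add_add {α : Type*} [MeasurableSpace α] {μ : Measure α} {f g h : α → ℝ}
    (hf : Integrable f μ) (hg : Integrable g μ) (hh : Integrable h μ) (a b : ℝ) :
    ∫ x, (f x + a * g x + b * h x) ∂μ = ∫ x, f x ∂μ + a * ∫ x, g x ∂μ + b * ∫ x, h x ∂μ := by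
  have h1 : Integrable (fun x => a * g x) μ := hg.const_mul a
  have h2 : Integrable (fun x => b * h x) μ := hh.const_mul b
  have h3 : Integrable (fun x => f x + a * g x) μ := hf.add h1
  rw [integral_add h3 h2, integral_add hf h1, integral_const_mul, integral_const_mul]

theorem integrable_mul_weight {μ : Measure (Edge Λ → ℝ)} [IsFiniteMeasure μ] (β : ℝ)
    (B : Finset (Fin d → ℤ)) {A : (Edge Λ → ℝ) → ℝ} {g : (Λ → ℝ) → ℝ} {M : ℝ}
    (hA : Measurable A) (hAM : ∀ ω, |A ω| ≤ M) (hg : Continuous g) (hb : ∀ θ, |g θ| ≤ 1) :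
    Integrable (fun p : (Edge Λ → ℝ) × (Λ → ℝ) => A p.1 * (g p.2 * gibbsWeight β Λ p.1 p.2))
      (μ.prod (refMeasure Λ B)) := by
  have hm : Measurable fun p : (Edge Λ → ℝ) × (Λ → ℝ) =>
      A p.1 * (g p.2 * gibbsWeight β Λ p.1 p.2) :=
    (hA.comp measurable_fst).mul
      ((hg.measurable.comp measurable_snd).mul (continuous_gibbsWeight β).measurable)
  refine Integrable.of_bound hm.aestronglyMeasurable
    (M * (1 * Real.exp (|β| * Fintype.card (Edge Λ)))) (Filter.Eventually.of_forall fun p => ?_)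
  rw [Real.norm_eq_abs, abs_mul, abs_mul, abs_of_pos (gibbsWeight_pos β p.1 p.2)]
  have := gibbsWeight_pos β p.1 p.2
  refine mul_le_mul (hAM _) (mul_le_mul (hb _) (gibbsWeight_le β _ _) this.le zero_le_one)
    (by positivity) ((abs_nonneg _).trans (hAM p.1))

theorem integrable_mul_rawExp {μ : Measure (Edge Λ → ℝ)} [IsFiniteMeasure μ] (β : ℝ)
    (B : Finset (Fin d → ℤ)) {A : (Edge Λ → ℝ) → ℝ} {g : (Λ → ℝ) → ℝ} {M : ℝ}
    (hA : Measurable A) (hAM : ∀ ω, |A ω| ≤ M) (hg : Continuous g) (hb : ∀ θ, |g θ| ≤ 1) :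
    Integrable (fun ω => A ω * rawExp β Λ B g ω) μ := by
  have := (integrable_mul_weight (μ := μ) β B hA hAM hg hb).integral_prod_left
  simpa only [integral_const_mul, rawExp] using this

/-- The constant relating the disorder law to the joint law of disorder and spins. -/
noncomputable def jointNorm (β : ℝ) (Λ B : Finset (Fin d → ℤ)) : ℝ :=
  ((refMeasure Λ B).real Set.univ)⁻¹ * ((edgeNorm β) ^ Fintype.card (Edge Λ))⁻¹

theorem jointNorm_pos (β : ℝ) (B : Finset (Fin d → ℤ)) : 0 < jointNorm β Λ B := by
  have h1 : 0 < (refMeasure Λ B).real Set.univ := by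
    rw [measureReal_def]
    exact ENNReal.toReal_pos (by simpa using refMeasure_ne_zero B) (measure_ne_top _ _)
  exact mul_pos (inv_pos.2 h1) (inv_pos.2 (pow_pos (edgeNorm_pos β) _))

/-- Averaging over gauge transformations: the disorder average of a function which is equivariant
under gauge transformations is an average over the joint law of disorder and spins. -/
theorem integral_disorderLaw_gauge (β : ℝ) (B : Finset (Fin d → ℤ)) (o : Λ)
    {k A C D : (Edge Λ → ℝ) → ℝ} {M : ℝ} (hk : Measurable k)
    (hA : Measurable A) (hC : Measurable C) (hD : Measurable D)
    (hAM : ∀ ω, |A ω| ≤ M) (hCM : ∀ ω, |C ω| ≤ M) (hDM : ∀ ω, |D ω| ≤ M) (hp : IsPeriodic k)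
    (heq : ∀ ω (φ : Λ → ℝ), (∀ i : Λ, (i : Fin d → ℤ) ∈ B → φ i = 0) →
      k (fun e => ω e + grad φ e) = A ω * Real.cos (φ o) + C ω * Real.sin (φ o) + D ω) :
    ∫ ω, k ω ∂(disorderLaw β Λ) = jointNorm β Λ B *
      ∫ ω, (A ω * rawExp β Λ B (fun θ => Real.cos (θ o)) ω +
        C ω * rawExp β Λ B (fun θ => Real.sin (θ o)) ω + D ω * partitionFn β Λ B ω)
        ∂(Measure.pi fun _ : Edge Λ => circleMeasure) := by
  set lam : Measure (Edge Λ → ℝ) := Measure.pi fun _ : Edge Λ => circleMeasure with hlam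
  set c : ℝ := ((edgeNorm β) ^ Fintype.card (Edge Λ))⁻¹ with hc
  have hW := continuous_gibbsWeight (Λ := Λ) β
  have hcos : Continuous fun θ : Λ → ℝ => Real.cos (θ o) := by fun_prop
  have hsin : Continuous fun θ : Λ → ℝ => Real.sin (θ o) := by fun_prop
  have hone : Continuous fun _ : Λ → ℝ => (1 : ℝ) := continuous_const
  have bcos : ∀ θ : Λ → ℝ, |Real.cos (θ o)| ≤ 1 := fun θ => Real.abs_cos_le_one _
  have bsin : ∀ θ : Λ → ℝ, |Real.sin (θ o)| ≤ 1 := fun θ => Real.abs_sin_le_one _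
  have bone : ∀ _ : Λ → ℝ, |(1 : ℝ)| ≤ 1 := fun _ => by simp
  -- For fixed `φ`, shifting `ω` by `grad φ` turns the density `gibbsWeight β Λ ω 0` into
  -- `gibbsWeight β Λ ω φ`.
  have step : ∀ φ : Λ → ℝ, (∀ i : Λ, (i : Fin d → ℤ) ∈ B → φ i = 0) →
      ∫ ω, k ω ∂(disorderLaw β Λ) =
        c * ∫ ω, (A ω * (Real.cos (φ o) * gibbsWeight β Λ ω φ) +
          C ω * (Real.sin (φ o) * gibbsWeight β Λ ω φ) +
          D ω * (1 * gibbsWeight β Λ ω φ)) ∂lam := by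
    intro φ hφ
    rw [integral_disorderLaw]
    simp_rw [gibbsWeight_zero]
    simp_rw [mul_assoc]
    rw [integral_const_mul]
    congr 1
    have hper : IsPeriodic fun ω => gibbsWeight β Λ ω 0 * k ω := by
      intro ω l
      have h1 := gibbsWeight_periodic_left β (0 : Λ → ℝ) ω l
      have h2 := hp ω l
      simp only at h1 ⊢
      rw [h1, h2]
    have hmeas : Measurable fun ω => gibbsWeight β Λ ω 0 * k ω :=
      (continuous_gibbsWeight_left β 0).measurable.mul hk
    have hs := integral_pi_shift (fun _ : Edge Λ => circleMeasure) (-Real.pi) (grad φ)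
      (fun i => Or.inr (by
        rw [circleMeasure]; congr 2; ring)) hper hmeas
    have hs' : ∫ ω, gibbsWeight β Λ (fun e => ω e + grad φ e) 0 * k (fun e => ω e + grad φ e)
        ∂lam = ∫ ω, gibbsWeight β Λ ω 0 * k ω ∂lam := by
      rw [hlam]; convert hs
    rw [← hs']
    refine integral_congr_ae (Filter.Eventually.of_forall fun ω => ?_)
    simp only
    rw [heq ω φ hφ, gibbsWeight_add_grad]
    simp only [Pi.zero_apply, zero_add]
    ring
  -- The left side of `step` does not depend on `φ`, so it may be averaged over `refMeasure`; the
  -- gauge field thereby becomes the spin variable.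
  have hconst : (refMeasure Λ B).real Set.univ * ∫ ω, k ω ∂(disorderLaw β Λ) =
      ∫ φ, c * ∫ ω, (A ω * (Real.cos (φ o) * gibbsWeight β Λ ω φ) +
          C ω * (Real.sin (φ o) * gibbsWeight β Λ ω φ) +
          D ω * (1 * gibbsWeight β Λ ω φ)) ∂lam ∂(refMeasure Λ B) := by
    rw [← smul_eq_mul, ← integral_const]
    refine integral_congr_ae ?_
    filter_upwards [ae_refMeasure_eq_zero B] with φ hφ
    exact step φ hφ
  have iA := integrable_mul_weight (μ := lam) β B hA hAM hcos bcos
  have iC := integrable_mul_weight (μ := lam) β B hC hCM hsin bsin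
  have iD := integrable_mul_weight (μ := lam) β B hD hDM hone bone
  have hsplit : ∫ φ, ∫ ω, (A ω * (Real.cos (φ o) * gibbsWeight β Λ ω φ) +
          C ω * (Real.sin (φ o) * gibbsWeight β Λ ω φ) +
          D ω * (1 * gibbsWeight β Λ ω φ)) ∂lam ∂(refMeasure Λ B) =
      ∫ ω, (A ω * rawExp β Λ B (fun θ => Real.cos (θ o)) ω +
        C ω * rawExp β Λ B (fun θ => Real.sin (θ o)) ω + D ω * partitionFn β Λ B ω) ∂lam := by
    rw [integral_integral_swap (f := fun φ ω => (A ω * (Real.cos (φ o) * gibbsWeight β Λ ω φ) +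
          C ω * (Real.sin (φ o) * gibbsWeight β Λ ω φ) +
          D ω * (1 * gibbsWeight β Λ ω φ))) (((iA.add iC).add iD).swap)]
    refine integral_congr_ae (Filter.Eventually.of_forall fun ω => ?_)
    have jA := (integrable_mul_gibbsWeight β B hcos bcos ω).const_mul (A ω)
    have jC := (integrable_mul_gibbsWeight β B hsin bsin ω).const_mul (C ω)
    have jD := (integrable_mul_gibbsWeight β B hone bone ω).const_mul (D ω)
    simp only
    have h3 := integral_add_add jA jC jD 1 1
    simp only [one_mul, integral_const_mul] at h3 ⊢
    rw [h3]
    simp only [rawExp, partitionFn]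
  rw [integral_const_mul, hsplit] at hconst
  have hR : (refMeasure Λ B).real Set.univ ≠ 0 := by
    rw [measureReal_def]
    exact (ENNReal.toReal_pos (by simpa using refMeasure_ne_zero B) (measure_ne_top _ _)).ne'
  rw [jointNorm, mul_assoc, ← hc, ← hconst, inv_mul_cancel_left₀ hR]

/-- On the Nishimori line, a gauge equivariant complex observable `X + i Y` with mean one gives the
lower bound `1 / E [X² + Y²]` on the magnetisation. -/
theorem one_le_second_moment_mul_nishimoriExp (β : ℝ) (B : Finset (Fin d → ℤ)) (o : Λ)
    {X Y : (Edge Λ → ℝ) → ℝ} {M : ℝ} (hX : Measurable X) (hY : Measurable Y)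
    (hXM : ∀ ω, |X ω| ≤ M) (hYM : ∀ ω, |Y ω| ≤ M) (hXp : IsPeriodic X) (hYp : IsPeriodic Y)
    (hXg : ∀ ω (φ : Λ → ℝ), (∀ i : Λ, (i : Fin d → ℤ) ∈ B → φ i = 0) →
      X (fun e => ω e + grad φ e) = X ω * Real.cos (φ o) - Y ω * Real.sin (φ o))
    (hYg : ∀ ω (φ : Λ → ℝ), (∀ i : Λ, (i : Fin d → ℤ) ∈ B → φ i = 0) →
      Y (fun e => ω e + grad φ e) = Y ω * Real.cos (φ o) + X ω * Real.sin (φ o))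
    (hmean : ∫ ω, X ω ∂(disorderLaw β Λ) = 1) :
    1 ≤ (∫ ω, (X ω ^ 2 + Y ω ^ 2) ∂(disorderLaw β Λ)) *
      nishimoriExp β Λ B (fun θ => Real.cos (θ o)) := by
  set lam : Measure (Edge Λ → ℝ) := Measure.pi fun _ : Edge Λ => circleMeasure with hlam
  have hcos : Continuous fun θ : Λ → ℝ => Real.cos (θ o) := by fun_prop
  have hsin : Continuous fun θ : Λ → ℝ => Real.sin (θ o) := by fun_prop
  have hone : Continuous fun _ : Λ → ℝ => (1 : ℝ) := continuous_const
  have bcos : ∀ θ : Λ → ℝ, |Real.cos (θ o)| ≤ 1 := fun θ => Real.abs_cos_le_one _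
  have bsin : ∀ θ : Λ → ℝ, |Real.sin (θ o)| ≤ 1 := fun θ => Real.abs_sin_le_one _
  have bone : ∀ _ : Λ → ℝ, |(1 : ℝ)| ≤ 1 := fun _ => by simp
  set c : (Edge Λ → ℝ) → ℝ := fun ω => gibbsExp β Λ B ω fun θ => Real.cos (θ o) with hc
  set s : (Edge Λ → ℝ) → ℝ := fun ω => gibbsExp β Λ B ω fun θ => Real.sin (θ o) with hs
  have mc : Measurable c := measurable_gibbsExp β B hcos
  have ms : Measurable s := measurable_gibbsExp β B hsin
  have bc : ∀ ω, |c ω| ≤ 1 := abs_gibbsExp_le β B hcos bcos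
  have bs : ∀ ω, |s ω| ≤ 1 := abs_gibbsExp_le β B hsin bsin
  have hcZ : ∀ ω, rawExp β Λ B (fun θ => Real.cos (θ o)) ω = c ω * partitionFn β Λ B ω :=
    fun ω => (div_mul_cancel₀ _ (partitionFn_pos β B ω).ne').symm
  have hsZ : ∀ ω, rawExp β Λ B (fun θ => Real.sin (θ o)) ω = s ω * partitionFn β Λ B ω :=
    fun ω => (div_mul_cancel₀ _ (partitionFn_pos β B ω).ne').symm
  have zero_le : ∀ ω : Edge Λ → ℝ, |(0 : ℝ)| ≤ 1 := fun _ => by simp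
  have hM0 : 0 ≤ M := (abs_nonneg _).trans (hXM 0)
  -- The Nishimori identity: `G` is the joint average of `c² + s²`. The next two applications treat
  -- `X` and `X² + Y²`.
  have hG := integral_disorderLaw_gauge β B o (k := c) (A := c) (C := s) (D := fun _ => 0)
    mc mc ms measurable_const bc bs zero_le (gibbsExp_periodic β B _) (fun ω φ hφ => by
      rw [add_zero]; exact gibbsExp_cos_add_grad β B o hφ ω)
  have hE := integral_disorderLaw_gauge β B o (k := X) (A := X) (C := fun ω => -Y ω)
    (D := fun _ => 0) hX hX hY.neg measurable_const hXM (fun ω => by rw [abs_neg]; exact hYM ω)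
    (fun _ => by simpa using hM0) hXp (fun ω φ hφ => by rw [hXg ω φ hφ]; ring)
  have hQM : ∀ ω, |X ω ^ 2 + Y ω ^ 2| ≤ M ^ 2 + M ^ 2 := fun ω => by
    rw [abs_of_nonneg (by positivity)]
    exact add_le_add (sq_le_sq' (abs_le.1 (hXM ω)).1 (abs_le.1 (hXM ω)).2)
      (sq_le_sq' (abs_le.1 (hYM ω)).1 (abs_le.1 (hYM ω)).2)
  have mQ : Measurable fun ω => X ω ^ 2 + Y ω ^ 2 := (hX.pow_const 2).add (hY.pow_const 2)
  have z0 : ∀ _ : Edge Λ → ℝ, |(0 : ℝ)| ≤ M ^ 2 + M ^ 2 := fun _ => by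
    rw [abs_zero]; positivity
  have hV := integral_disorderLaw_gauge β B o (k := fun ω => X ω ^ 2 + Y ω ^ 2)
    (A := fun _ => 0) (C := fun _ => 0) (D := fun ω => X ω ^ 2 + Y ω ^ 2) mQ measurable_const
    measurable_const mQ z0 z0 hQM (fun ω l => by beta_reduce; rw [hXp ω l, hYp ω l])
    (fun ω φ hφ => by
      rw [hXg ω φ hφ, hYg ω φ hφ]
      linear_combination (X ω ^ 2 + Y ω ^ 2) * Real.sin_sq_add_cos_sq (φ o))
  have hnish : nishimoriExp β Λ B (fun θ => Real.cos (θ o)) = ∫ ω, c ω ∂(disorderLaw β Λ) := rfl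
  rw [hnish]
  set V := ∫ ω, (X ω ^ 2 + Y ω ^ 2) ∂(disorderLaw β Λ)
  set G := ∫ ω, c ω ∂(disorderLaw β Λ)
  rw [hmean] at hE
  simp only [hcZ, hsZ, zero_mul, add_zero, zero_add] at hG hE hV
  have hK := jointNorm_pos (Λ := Λ) β B
  have intg : ∀ (D : (Edge Λ → ℝ) → ℝ) (M' : ℝ), Measurable D → (∀ ω, |D ω| ≤ M') →
      Integrable (fun ω => D ω * partitionFn β Λ B ω) lam := by
    intro D M' hD hb
    simp_rw [partitionFn_eq]
    exact integrable_mul_rawExp β B hD hb hone bone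
  have iG : Integrable (fun ω => c ω * (c ω * partitionFn β Λ B ω) +
      s ω * (s ω * partitionFn β Λ B ω)) lam := by
    simp_rw [← mul_assoc]
    refine (intg _ (1 * 1) (mc.mul mc) fun ω => ?_).add (intg _ (1 * 1) (ms.mul ms) fun ω => ?_)
    · rw [Pi.mul_apply, abs_mul]; exact mul_le_mul (bc ω) (bc ω) (abs_nonneg _) zero_le_one
    · rw [abs_mul]; exact mul_le_mul (bs ω) (bs ω) (abs_nonneg _) zero_le_one
  have iE : Integrable (fun ω => X ω * (c ω * partitionFn β Λ B ω) +
      -Y ω * (s ω * partitionFn β Λ B ω)) lam := by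
    simp_rw [← mul_assoc]
    refine (intg _ (M * 1) (hX.mul mc) fun ω => ?_).add
      (intg _ (M * 1) (hY.neg.mul ms) fun ω => ?_)
    · rw [Pi.mul_apply, abs_mul]; exact mul_le_mul (hXM ω) (bc ω) (abs_nonneg _) hM0
    · rw [abs_mul, abs_neg]; exact mul_le_mul (hYM ω) (bs ω) (abs_nonneg _) hM0
  have iV : Integrable (fun ω => (X ω ^ 2 + Y ω ^ 2) * partitionFn β Λ B ω) lam :=
    intg _ _ mQ hQM
  -- Cauchy–Schwarz in discriminant form: the quadratic is the joint average of `|(X + iY) - l (c -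
  -- is)|²`.
  have quad : ∀ l : ℝ, 0 ≤ G * (l * l) + (-2) * l + V := by
    intro l
    have : G * (l * l) + (-2) * l + V = jointNorm β Λ B *
        ∫ ω, ((X ω - l * c ω) ^ 2 + (Y ω + l * s ω) ^ 2) * partitionFn β Λ B ω ∂lam := by
      have h : ∀ ω, ((X ω - l * c ω) ^ 2 + (Y ω + l * s ω) ^ 2) * partitionFn β Λ B ω =
          (X ω ^ 2 + Y ω ^ 2) * partitionFn β Λ B ω +
          (-2 * l) * (X ω * (c ω * partitionFn β Λ B ω) +
            -Y ω * (s ω * partitionFn β Λ B ω)) +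
          (l * l) * (c ω * (c ω * partitionFn β Λ B ω) +
            s ω * (s ω * partitionFn β Λ B ω)) := fun ω => by ring
      simp_rw [h]
      rw [integral_add_add iV iE iG]
      linear_combination (l * l) * hG - 2 * l * hE + hV
    rw [this]
    refine mul_nonneg hK.le (integral_nonneg fun ω => mul_nonneg (by positivity)
      (partitionFn_pos β B ω).le)
  have := discrim_le_zero quad
  rw [discrim] at this
  linarith


/-! ### Moments of the disorder -/

theorem integral_sin_edgeLaw (u c : ℝ) : ∫ w, Real.sin (c * w) ∂(edgeLaw u) = 0 := by
  rw [integral_edgeLaw, integral_circleMeasure]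
  have h := intervalIntegral.integral_comp_neg (a := -Real.pi) (b := Real.pi)
    (fun w => edgeDensity u w * Real.sin (c * w))
  simp only [edgeDensity, Real.cos_neg, mul_neg, Real.sin_neg, neg_neg,
    intervalIntegral.integral_neg] at h ⊢
  linarith

/-- The mean of the cosine of an edge variable. -/
noncomputable def edgeMean (u : ℝ) : ℝ := ∫ w, Real.cos w ∂(edgeLaw u)

theorem integral_cexp_edgeLaw (u c : ℝ) :
    ∫ w, Complex.exp ((c * w : ℝ) * Complex.I) ∂(edgeLaw u) =
      ((∫ w, Real.cos (c * w) ∂(edgeLaw u) : ℝ) : ℂ) := by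
  have hi : Integrable (fun w : ℝ => Complex.exp ((c * w : ℝ) * Complex.I)) (edgeLaw u) :=
    Integrable.of_bound (Continuous.aestronglyMeasurable (by fun_prop)) 1
      (Filter.Eventually.of_forall fun w => (Complex.norm_exp_ofReal_mul_I _).le)
  apply Complex.ext
  · have := integral_re hi
    simp only [RCLike.re_to_complex, Complex.exp_ofReal_mul_I_re] at this
    rw [← this, Complex.ofReal_re]
  · have := integral_im hi
    simp only [RCLike.im_to_complex, Complex.exp_ofReal_mul_I_im] at this
    rw [← this, Complex.ofReal_im, integral_sin_edgeLaw]

/-- Characteristic functions of independent variables multiply, and each factor is real because the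
edge law is symmetric. -/
theorem integral_cos_sum (u : ℝ) (c : Edge Λ → ℝ) :
    ∫ ω, Real.cos (∑ e, c e * ω e) ∂(disorderLaw u Λ) =
      ∏ e, ∫ w, Real.cos (c e * w) ∂(edgeLaw u) := by
  have hi : Integrable (fun ω : Edge Λ → ℝ =>
      Complex.exp ((∑ e, c e * ω e : ℝ) * Complex.I)) (disorderLaw u Λ) :=
    Integrable.of_bound (Continuous.aestronglyMeasurable (by fun_prop)) 1
      (Filter.Eventually.of_forall fun w => (Complex.norm_exp_ofReal_mul_I _).le)
  have h := integral_re hi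
  simp only [RCLike.re_to_complex, Complex.exp_ofReal_mul_I_re] at h
  rw [h]
  have h2 : ∫ ω : Edge Λ → ℝ, Complex.exp ((∑ e, c e * ω e : ℝ) * Complex.I)
      ∂(disorderLaw u Λ) = ∏ e, ((∫ w, Real.cos (c e * w) ∂(edgeLaw u) : ℝ) : ℂ) := by
    simp_rw [← integral_cexp_edgeLaw]
    have h3 := integral_fintype_prod_eq_prod (𝕜 := ℂ) (μ := fun _ : Edge Λ => edgeLaw u)
      (fun e w => Complex.exp ((c e * w : ℝ) * Complex.I))
    rw [← h3]
    unfold disorderLaw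
    refine integral_congr_ae (Filter.Eventually.of_forall fun ω => ?_)
    beta_reduce
    rw [← Complex.exp_sum, ← Finset.sum_mul]
    push_cast
    rfl
  rw [h2, ← Complex.ofReal_prod, Complex.ofReal_re]

theorem edgeMean_le_one (u : ℝ) : edgeMean u ≤ 1 := by
  have := norm_integral_le_of_norm_le_const (μ := edgeLaw u) (f := fun w => Real.cos w) (C := 1)
    (Filter.Eventually.of_forall fun w => Real.abs_cos_le_one w)
  simp only [probReal_univ, mul_one] at this
  exact (le_abs_self _).trans this

/-! ### Concentration of an edge variable for large `β` -/

/-- Only `|t| ≤ 1 / √β` is kept, where `cos t ≥ 1 - t² / 2` makes the exponent at least `β - 1 / 2`.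
-/
theorem edgeNorm_ge {β : ℝ} (hβ : 1 ≤ β) :
    2 / Real.sqrt β * Real.exp (β - 1 / 2) ≤ edgeNorm β := by
  have hs : 1 ≤ Real.sqrt β := Real.one_le_sqrt.2 hβ
  have hs0 : 0 < Real.sqrt β := by linarith
  have hr : (Real.sqrt β)⁻¹ ≤ 1 := inv_le_one_of_one_le₀ hs
  have hr0 : 0 < (Real.sqrt β)⁻¹ := inv_pos.2 hs0
  have hpi := Real.pi_gt_three
  have h1 : ∫ _ in (-(Real.sqrt β)⁻¹)..(Real.sqrt β)⁻¹, Real.exp (β - 1 / 2) =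
      2 / Real.sqrt β * Real.exp (β - 1 / 2) := by
    rw [intervalIntegral.integral_const, smul_eq_mul]
    ring
  rw [← h1]
  have hcont : Continuous fun t => Real.exp (β * Real.cos t) := by fun_prop
  calc ∫ _ in (-(Real.sqrt β)⁻¹)..(Real.sqrt β)⁻¹, Real.exp (β - 1 / 2)
      ≤ ∫ t in (-(Real.sqrt β)⁻¹)..(Real.sqrt β)⁻¹, Real.exp (β * Real.cos t) := by
        refine intervalIntegral.integral_mono_on (by linarith)
          (by simp) (hcont.intervalIntegrable _ _) fun t ht => ?_
        apply Real.exp_le_exp.2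
        have h2 := Real.one_sub_sq_div_two_le_cos (x := t)
        have h3 : t ^ 2 ≤ ((Real.sqrt β)⁻¹) ^ 2 := sq_le_sq' ht.1 ht.2
        rw [inv_pow, Real.sq_sqrt (by linarith)] at h3
        have h4 : β * t ^ 2 ≤ 1 := by
          calc β * t ^ 2 ≤ β * β⁻¹ := mul_le_mul_of_nonneg_left h3 (by linarith)
            _ = 1 := mul_inv_cancel₀ (by linarith)
        nlinarith [mul_le_mul_of_nonneg_left h2 (by linarith : 0 ≤ β)]
    _ ≤ edgeNorm β := by
        refine intervalIntegral.integral_mono_interval (by linarith) (by linarith) (by linarith)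
          (Filter.Eventually.of_forall fun t => (Real.exp_pos _).le)
          (hcont.intervalIntegrable _ _)

/-- With `x = β (1 - cos t)`, the inequality `x exp (-x) ≤ exp (-x / 2)` and `cos t ≤ 1 - 2 t² / π²`
bound the integrand by a Gaussian. -/
theorem integral_one_sub_cos_le {β : ℝ} (hβ : 0 < β) :
    ∫ t in (-Real.pi)..Real.pi, (1 - Real.cos t) * Real.exp (β * Real.cos t) ≤
      Real.exp β / β * (Real.pi * Real.sqrt (Real.pi / β)) := by
  have hpi := Real.pi_pos
  have hb : 0 < β / Real.pi ^ 2 := by positivity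
  have hg := integral_gaussian (β / Real.pi ^ 2)
  have hint := integrable_exp_neg_mul_sq hb
  have hsq : Real.sqrt (Real.pi / (β / Real.pi ^ 2)) = Real.pi * Real.sqrt (Real.pi / β) := by
    rw [show Real.pi / (β / Real.pi ^ 2) = Real.pi ^ 2 * (Real.pi / β) by field_simp,
      Real.sqrt_mul (by positivity), Real.sqrt_sq hpi.le]
  rw [hsq] at hg
  rw [← hg, ← integral_const_mul]
  calc ∫ t in (-Real.pi)..Real.pi, (1 - Real.cos t) * Real.exp (β * Real.cos t)
      ≤ ∫ t in (-Real.pi)..Real.pi,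
          Real.exp β / β * Real.exp (-(β / Real.pi ^ 2) * t ^ 2) := by
        refine intervalIntegral.integral_mono_on (by linarith)
          (Continuous.intervalIntegrable (by fun_prop) _ _)
          (Continuous.intervalIntegrable (by fun_prop) _ _) fun t ht => ?_
        have hc : Real.cos t ≤ 1 - 2 / Real.pi ^ 2 * t ^ 2 :=
          Real.cos_le_one_sub_mul_cos_sq (abs_le.2 ht)
        set x := β * (1 - Real.cos t) with hx
        have hx0 : 0 ≤ x := mul_nonneg hβ.le (by linarith [Real.cos_le_one t])
        have h1 : x * Real.exp (-x) ≤ Real.exp (-(x / 2)) := by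
          have h2 : x ≤ Real.exp (x / 2) := by
            have := Real.add_one_le_exp (x / 4)
            have h3 : Real.exp (x / 2) = Real.exp (x / 4) ^ 2 := by
              rw [← Real.exp_nat_mul]; congr 1; push_cast; ring
            rw [h3]
            nlinarith [sq_nonneg (x / 4 - 1)]
          calc x * Real.exp (-x) ≤ Real.exp (x / 2) * Real.exp (-x) :=
                mul_le_mul_of_nonneg_right h2 (Real.exp_pos _).le
            _ = Real.exp (-(x / 2)) := by rw [← Real.exp_add]; congr 1; ring
        have h4 : Real.exp (-(x / 2)) ≤ Real.exp (-(β / Real.pi ^ 2) * t ^ 2) := by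
          apply Real.exp_le_exp.2
          have := mul_le_mul_of_nonneg_left hc hβ.le
          have h5 : β * (1 - 2 / Real.pi ^ 2 * t ^ 2) =
              β - 2 * (β / Real.pi ^ 2 * t ^ 2) := by ring
          rw [hx]
          linarith
        have h6 : (1 - Real.cos t) * Real.exp (β * Real.cos t) =
            Real.exp β / β * (x * Real.exp (-x)) := by
          have : Real.exp (β * Real.cos t) = Real.exp β * Real.exp (-x) := by
            rw [← Real.exp_add]; congr 1; rw [hx]; ring
          rw [this, hx]
          field_simp
        rw [h6]
        exact mul_le_mul_of_nonneg_left (h1.trans h4) (by positivity)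
    _ ≤ ∫ t, Real.exp β / β * Real.exp (-(β / Real.pi ^ 2) * t ^ 2) := by
        rw [intervalIntegral.integral_of_le (by linarith)]
        exact setIntegral_le_integral (hint.const_mul _)
          (Filter.Eventually.of_forall fun t => by positivity)

theorem one_sub_edgeMean_le {β : ℝ} (hβ : 1 ≤ β) :
    1 - edgeMean β ≤ (Real.pi * Real.sqrt Real.pi * Real.exp (1 / 2) / 2) / β := by
  have hβ0 : 0 < β := by linarith
  have hN := edgeNorm_pos β
  have h1 : 1 - edgeMean β =
      (∫ t in (-Real.pi)..Real.pi, (1 - Real.cos t) * Real.exp (β * Real.cos t)) /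
        edgeNorm β := by
    have hone : 1 = ∫ t in (-Real.pi)..Real.pi, edgeDensity β t := by
      rw [← integral_circleMeasure, integral_edgeDensity]
    conv_lhs => rw [hone, edgeMean, integral_edgeLaw, integral_circleMeasure]
    rw [← intervalIntegral.integral_div, ← intervalIntegral.integral_sub]
    · refine intervalIntegral.integral_congr fun t _ => ?_
      simp only [edgeDensity]
      ring
    · exact (continuous_edgeDensity β).intervalIntegrable _ _
    · exact ((continuous_edgeDensity β).mul Real.continuous_cos).intervalIntegrable _ _
  have hs0 : 0 < Real.sqrt β := Real.sqrt_pos.2 hβ0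
  rw [h1, div_le_iff₀ hN]
  refine (integral_one_sub_cos_le hβ0).trans ?_
  refine le_trans (le_of_eq ?_) (mul_le_mul_of_nonneg_left (edgeNorm_ge hβ) (by positivity))
  have he : Real.exp β = Real.exp (1 / 2) * Real.exp (β - 1 / 2) := by
    rw [← Real.exp_add]; congr 1; ring
  rw [he, Real.sqrt_div Real.pi_pos.le]
  field_simp

end NishimoriXY

namespace NishimoriXY

open MeasureTheory

/-! ### Exponential moments of the number of collisions -/

/-- Exchanging the overridden parts is an involution of pairs, so splicing two independent uniform
configurations gives a uniform one. -/
theorem sum_sum_override {Ω : Type*} [Fintype Ω] (ov : Ω → Ω → Ω)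
    (hinv : ∀ w u, ov (ov w u) (ov u w) = w) (G : Ω → ℝ) :
    ∑ u, ∑ u', G (ov u u') = Fintype.card Ω * ∑ u, G u := by
  have hE : Function.Involutive fun p : Ω × Ω => (ov p.1 p.2, ov p.2 p.1) := fun p =>
    Prod.ext (hinv _ _) (hinv _ _)
  have h1 : ∑ p : Ω × Ω, G (ov p.1 p.2) = ∑ p : Ω × Ω, G p.1 :=
    Equiv.sum_comp (Function.Involutive.toPerm _ hE) (fun p => G p.1)
  rw [Fintype.sum_prod_type, Fintype.sum_prod_type] at h1
  rw [h1]
  simp [Finset.mul_sum]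

-- Telescoping as the left endpoint decreases from `n` to `t`: a collision at `r` multiplies the
-- power by `q`, an increment of `q - 1` times the power counting later collisions.
open Classical in
theorem pow_card_eq_one_add (coll : ℕ → Prop) (q : ℝ) (n t : ℕ) (h : t ≤ n) :
    q ^ ((Finset.Ioc t n).filter coll).card = 1 + (q - 1) * ∑ r ∈ Finset.Ioc t n,
      (if coll r then q ^ ((Finset.Ioc r n).filter coll).card else 0) := by
  induction h using Nat.decreasingInduction with
  | self => simp
  | of_succ t ht ih =>
    have hins : Finset.Ioc t n = insert (t + 1) (Finset.Ioc (t + 1) n) := by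
      ext x; simp only [Finset.mem_Ioc, Finset.mem_insert]; omega
    have hnot : t + 1 ∉ Finset.Ioc (t + 1) n := by simp
    rw [hins, Finset.sum_insert hnot, mul_add, Finset.filter_insert]
    by_cases hc : coll (t + 1)
    · rw [if_pos hc, if_pos hc, Finset.card_insert_of_notMem (by simp), pow_succ]
      linear_combination ih
    · rw [if_neg hc, if_neg hc, ih]
      ring

open Classical in
/-- If, conditionally on the configuration up to time `t`, a collision at time `r` has probability
at most `p (r - t)` with `∑ p ≤ c`, then the number of collisions has exponential moments. -/
theorem sum_pow_card_collisions_le {Ω : Type*} [Fintype Ω] (ov : ℕ → Ω → Ω → Ω)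
    (hinv : ∀ s w u, ov s (ov s w u) (ov s u w) = w)
    (hcomp : ∀ s t, t ≤ s → ∀ w u u', ov s (ov t w u) u' = ov t w (ov s u u'))
    (coll : ℕ → Ω → Prop) (hcoll : ∀ s r, r ≤ s → ∀ w u, coll r (ov s w u) ↔ coll r w)
    (p : ℕ → ℝ) (hp0 : ∀ k, 0 ≤ p k) (n : ℕ)
    (hp : ∀ t r, t < r → r ≤ n → ∀ w,
      ∑ u, (if coll r (ov t w u) then (1 : ℝ) else 0) ≤ Fintype.card Ω * p (r - t))
    {q c g : ℝ} (hq : 1 ≤ q) (hc : ∑ k ∈ Finset.Icc 1 n, p k ≤ c) (hg0 : 0 ≤ g)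
    (hg : 1 + (q - 1) * (c * g) ≤ g) (t : ℕ) (ht : t ≤ n) :
    ∀ w, ∑ u, q ^ ((Finset.Ioc t n).filter fun r => coll r (ov t w u)).card ≤
      Fintype.card Ω * g := by
  have hg1 : 1 ≤ g := by
    have : 0 ≤ c := (Finset.sum_nonneg fun k _ => hp0 k).trans hc
    have : 0 ≤ (q - 1) * (c * g) := mul_nonneg (by linarith) (by positivity)
    linarith
  induction hm : n - t using Nat.strong_induction_on generalizing t with
  | _ m ih =>
    intro w
    rcases isEmpty_or_nonempty Ω with hΩ | hΩ
    · simp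
    have hcard : (0 : ℝ) < Fintype.card Ω := by exact_mod_cast Fintype.card_pos
    -- The configuration is resampled after `r`. The collision at `r` costs `p (r - t)`, and the
    -- later collisions are bounded by the induction hypothesis started at `r`.
    have key : ∀ r ∈ Finset.Ioc t n,
        ∑ u, (if coll r (ov t w u) then
          q ^ ((Finset.Ioc r n).filter fun s => coll s (ov t w u)).card else 0) ≤
          Fintype.card Ω * p (r - t) * g := by
      intro r hr
      rw [Finset.mem_Ioc] at hr
      set G : Ω → ℝ := fun v => if coll r (ov t w v) then
        q ^ ((Finset.Ioc r n).filter fun s => coll s (ov t w v)).card else 0 with hG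
      have h1 := sum_sum_override (ov r) (hinv r) G
      have h2 : ∀ u, ∑ u', G (ov r u u') ≤
          (if coll r (ov t w u) then (1 : ℝ) else 0) * (Fintype.card Ω * g) := by
        intro u
        simp only [hG, ← hcomp r t hr.1.le]
        simp only [hcoll r r le_rfl]
        split_ifs
        · rw [one_mul]
          exact ih (n - r) (by omega) r hr.2 rfl (ov t w u)
        · simp
      have h3 : Fintype.card Ω * ∑ u, G u ≤
          (Fintype.card Ω * p (r - t)) * (Fintype.card Ω * g) := by
        rw [← h1]
        refine (Finset.sum_le_sum fun u _ => h2 u).trans ?_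
        rw [← Finset.sum_mul]
        exact mul_le_mul_of_nonneg_right (hp t r hr.1 hr.2 w) (by positivity)
      refine le_of_mul_le_mul_left (h3.trans (le_of_eq ?_)) hcard
      ring
    have hsum : ∑ r ∈ Finset.Ioc t n, p (r - t) ≤ c := by
      refine le_trans ?_ hc
      rw [← Finset.sum_image (s := Finset.Ioc t n) (g := fun r => r - t) (f := p)]
      · refine Finset.sum_le_sum_of_subset_of_nonneg ?_ fun k _ _ => hp0 k
        intro k hk
        simp only [Finset.mem_image, Finset.mem_Ioc, Finset.mem_Icc] at hk ⊢
        omega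
      · intro a ha b hb hab
        simp only [Finset.coe_Ioc, Set.mem_Ioc] at ha hb hab
        omega
    simp_rw [fun u => pow_card_eq_one_add (fun r => coll r (ov t w u)) q n t ht]
    rw [Finset.sum_add_distrib, ← Finset.mul_sum, Finset.sum_comm]
    have h4 : ∑ r ∈ Finset.Ioc t n, ∑ u, (if coll r (ov t w u) then
          q ^ ((Finset.Ioc r n).filter fun s => coll s (ov t w u)).card else 0) ≤
          Fintype.card Ω * (c * g) := by
      refine (Finset.sum_le_sum key).trans ?_
      rw [← Finset.sum_mul, ← Finset.mul_sum, mul_assoc]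
      exact mul_le_mul_of_nonneg_left (mul_le_mul_of_nonneg_right hsum hg0) hcard.le
    have h5 := mul_le_mul_of_nonneg_left h4 (by linarith : 0 ≤ q - 1)
    have h6 : ∑ _u : Ω, (1 : ℝ) = Fintype.card Ω := by simp
    have h7 := mul_le_mul_of_nonneg_left hg hcard.le
    rw [h6]
    linarith

/-! ### An unpredictable monotone walk -/

/-- Independent uniform variables indexed by a dyadic scale and a block at this scale. -/
abbrev Config (L : ℕ) : Type := Fin L × Fin L → Fin L

variable {L : ℕ}

/-- The variable of scale `j` and block `b`, rescaled to `[0, 1]`. -/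
noncomputable def blockVar (u : Config L) (j b : ℕ) : ℝ :=
  if h : j < L ∧ b < L then ((u (⟨j, h.1⟩, ⟨b, h.2⟩) : ℕ) : ℝ) / L else 0

theorem blockVar_nonneg (u : Config L) (j b : ℕ) : 0 ≤ blockVar u j b := by
  unfold blockVar; split_ifs <;> positivity

theorem blockVar_le_one (u : Config L) (j b : ℕ) : blockVar u j b ≤ 1 := by
  unfold blockVar
  split_ifs with h
  · refine div_le_one_of_le₀ ?_ (by positivity)
    exact_mod_cast (u (⟨j, h.1⟩, ⟨b, h.2⟩)).2.le
  · exact zero_le_one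

/-- The velocity at time `s`: a superposition of velocities at all dyadic scales. -/
noncomputable def velocity (u : Config L) (s : ℕ) : ℝ :=
  ∑ j ∈ Finset.range L, 1 / 4 * (3 / 4) ^ j * blockVar u j (s / 2 ^ j)

theorem velocity_nonneg (u : Config L) (s : ℕ) : 0 ≤ velocity u s :=
  Finset.sum_nonneg fun _ _ => mul_nonneg (by positivity) (blockVar_nonneg _ _ _)

/-- The weights sum to `1 - (3 / 4) ^ L`. Speed at most one is what lets the integer part advance by
at most one. -/
theorem velocity_le_one (u : Config L) (s : ℕ) : velocity u s ≤ 1 := by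
  have h1 : velocity u s ≤ ∑ j ∈ Finset.range L, 1 / 4 * (3 / 4 : ℝ) ^ j :=
    Finset.sum_le_sum fun j _ => mul_le_of_le_one_right (by positivity) (blockVar_le_one _ _ _)
  refine h1.trans ?_
  rw [← Finset.mul_sum, geom_sum_eq (by norm_num)]
  have h2 : (0 : ℝ) ≤ (3 / 4) ^ L := by positivity
  have h3 : 1 / 4 * (((3 / 4 : ℝ) ^ L - 1) / (3 / 4 - 1)) = 1 - (3 / 4) ^ L := by ring
  linarith

/-- The position at time `t`. -/
noncomputable def position (u : Config L) (t : ℕ) : ℝ := ∑ s ∈ Finset.range t, velocity u s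

theorem position_nonneg (u : Config L) (t : ℕ) : 0 ≤ position u t :=
  Finset.sum_nonneg fun _ _ => velocity_nonneg _ _

/-- The walk on the integers following the position. -/
noncomputable def walk (u : Config L) (t : ℕ) : ℕ := ⌊position u t⌋₊

theorem walk_zero (u : Config L) : walk u 0 = 0 := by simp [walk, position]

theorem walk_succ (u : Config L) (t : ℕ) :
    walk u (t + 1) = walk u t ∨ walk u (t + 1) = walk u t + 1 := by
  have h : position u (t + 1) = position u t + velocity u t := Finset.sum_range_succ _ _
  have h1 : walk u t ≤ walk u (t + 1) :=
    Nat.floor_mono (by rw [h]; linarith [velocity_nonneg u t])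
  have h2 : walk u (t + 1) ≤ walk u t + 1 := by
    rw [walk, walk, ← Nat.floor_add_one (position_nonneg u t)]
    exact Nat.floor_mono (by rw [h]; linarith [velocity_le_one u t])
  omega

theorem walk_le (u : Config L) (t : ℕ) : walk u t ≤ t := by
  induction t with
  | zero => rw [walk_zero]
  | succ t ih => rcases walk_succ u t with h | h <;> omega

/-! ### Resampling the future, and unpredictability -/

/-- The configuration agreeing with `w` on blocks starting before time `t` and with `u`
otherwise. -/
def override (t : ℕ) (w u : Config L) : Config L :=
  fun i => if (i.2 : ℕ) * 2 ^ (i.1 : ℕ) < t then w i else u i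

theorem override_zero (w u : Config L) : override 0 w u = u := by
  funext i; simp [override]

theorem override_override_swap (t : ℕ) (w u : Config L) :
    override t (override t w u) (override t u w) = w := by
  funext i; simp only [override]; split_ifs <;> rfl

theorem override_override {s t : ℕ} (h : t ≤ s) (w u u' : Config L) :
    override s (override t w u) u' = override t w (override s u u') := by
  funext i; simp only [override]; split_ifs <;> first | rfl | omega

/-- The walk is adapted: up to time `r` it only reads blocks starting before `r`. -/
theorem walk_override {s r : ℕ} (h : r ≤ s) (w u : Config L) :
    walk (override s w u) r = walk w r := by
  have : position (override s w u) r = position w r := by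
    refine Finset.sum_congr rfl fun x hx => Finset.sum_congr rfl fun j _ => ?_
    have hx' : x < r := Finset.mem_range.1 hx
    have h1 : x / 2 ^ j * 2 ^ j < s := (Nat.div_mul_le_self x (2 ^ j)).trans_lt (by omega)
    simp only [blockVar, override, h1, if_true]
  rw [walk, walk, this]

theorem blockVar_update (v : Config L) (i : Fin L × Fin L) (σ z : Fin L) (hz : (z : ℕ) = 0)
    (j b : ℕ) :
    blockVar (Function.update v i σ) j b = blockVar (Function.update v i z) j b +
      if j = i.1 ∧ b = i.2 then (σ : ℝ) / L else 0 := by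
  by_cases h : j = i.1 ∧ b = i.2
  · obtain ⟨rfl, rfl⟩ := h
    have h' : (i.1 : ℕ) < L ∧ (i.2 : ℕ) < L := ⟨i.1.2, i.2.2⟩
    simp [blockVar, hz]
  · rw [if_neg h, add_zero]
    unfold blockVar
    split_ifs with h'
    · have hne : ((⟨j, h'.1⟩, ⟨b, h'.2⟩) : Fin L × Fin L) ≠ i := by
        rintro rfl
        exact h ⟨rfl, rfl⟩
      rw [Function.update_of_ne hne, Function.update_of_ne hne]
    · rfl

/-- A completed block of scale `j` lasts `2 ^ j` steps at weight `(3 / 4) ^ j / 4`, so its variable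
displaces the position over a range of order `(3 / 2) ^ j`. Long blocks thus have a growing effect
although their weights decay. -/
theorem position_update (v : Config L) (i : Fin L × Fin L) (σ z : Fin L) (hz : (z : ℕ) = 0)
    {r : ℕ} (hr : ((i.2 : ℕ) + 1) * 2 ^ (i.1 : ℕ) ≤ r) :
    position (Function.update v i σ) r = position (Function.update v i z) r +
      1 / 4 * (3 / 2) ^ (i.1 : ℕ) * ((σ : ℝ) / L) := by
  have hv : ∀ s, velocity (Function.update v i σ) s = velocity (Function.update v i z) s +
      1 / 4 * (3 / 4) ^ (i.1 : ℕ) * ((σ : ℝ) / L) *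
        (if s / 2 ^ (i.1 : ℕ) = (i.2 : ℕ) then 1 else 0) := by
    intro s
    unfold velocity
    simp_rw [blockVar_update v i σ z hz, mul_add]
    rw [Finset.sum_add_distrib]
    congr 1
    rw [Finset.sum_eq_single (i.1 : ℕ)]
    · simp
    · intro j _ hj
      simp [hj]
    · intro h
      exact absurd (Finset.mem_range.2 i.1.2) h
  unfold position
  simp_rw [hv]
  rw [Finset.sum_add_distrib, ← Finset.mul_sum]
  have hcard : ∑ s ∈ Finset.range r, (if s / 2 ^ (i.1 : ℕ) = (i.2 : ℕ) then (1 : ℝ) else 0) =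
      2 ^ (i.1 : ℕ) := by
    rw [Finset.sum_boole]
    have : (Finset.range r).filter (fun s => s / 2 ^ (i.1 : ℕ) = (i.2 : ℕ)) =
        Finset.Ico ((i.2 : ℕ) * 2 ^ (i.1 : ℕ)) (((i.2 : ℕ) + 1) * 2 ^ (i.1 : ℕ)) := by
      ext s
      simp only [Finset.mem_filter, Finset.mem_range, Finset.mem_Ico]
      rw [Nat.div_eq_iff (by positivity)]
      have : (2 : ℕ) ^ (i.1 : ℕ) > 0 := by positivity
      have h2 : ((i.2 : ℕ) + 1) * 2 ^ (i.1 : ℕ) = (i.2 : ℕ) * 2 ^ (i.1 : ℕ) + 2 ^ (i.1 : ℕ) := by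
        ring
      omega
    rw [this, Nat.card_Ico]
    have h2 : ((i.2 : ℕ) + 1) * 2 ^ (i.1 : ℕ) - (i.2 : ℕ) * 2 ^ (i.1 : ℕ) = 2 ^ (i.1 : ℕ) := by
      rw [add_mul, one_mul, Nat.add_sub_cancel_left]
    rw [h2]
    push_cast
    rfl
  rw [hcard]
  have : (3 / 2 : ℝ) ^ (i.1 : ℕ) = (3 / 4) ^ (i.1 : ℕ) * 2 ^ (i.1 : ℕ) := by
    rw [← mul_pow]; norm_num
  rw [this]
  ring

/-- The points have spacing `h`, and those with integer part `m` lie in one unit interval. -/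
theorem card_floor_eq_le {x h : ℝ} (hx : 0 ≤ x) (hh : 0 < h) (m : ℕ) :
    (((Finset.univ : Finset (Fin L)).filter fun σ : Fin L => ⌊x + h * (σ : ℕ)⌋₊ = m).card : ℝ) ≤
      1 / h + 1 := by
  set A := (Finset.univ : Finset (Fin L)).filter fun σ : Fin L => ⌊x + h * (σ : ℕ)⌋₊ = m with hA
  rcases A.eq_empty_or_nonempty with h0 | hne
  · rw [h0]; simp; positivity
  have hsub : A ⊆ Finset.Icc (A.min' hne) (A.max' hne) := fun σ hσ =>
    Finset.mem_Icc.2 ⟨A.min'_le σ hσ, A.le_max' σ hσ⟩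
  have h1 := (Finset.mem_filter.1 (A.min'_mem hne)).2
  have h2 := (Finset.mem_filter.1 (A.max'_mem hne)).2
  have hle : A.min' hne ≤ A.max' hne := A.min'_le _ (A.max'_mem hne)
  rw [Nat.floor_eq_iff (by positivity)] at h1 h2
  have hc : A.card ≤ (A.max' hne : ℕ) - (A.min' hne : ℕ) + 1 := by
    refine (Finset.card_le_card hsub).trans ?_
    rw [Fin.card_Icc]
    have : (A.min' hne : ℕ) ≤ (A.max' hne : ℕ) := hle
    omega
  have hc' : (A.card : ℝ) ≤ ((A.max' hne : ℕ) : ℝ) - ((A.min' hne : ℕ) : ℝ) + 1 := by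
    rw [← Nat.cast_sub (show (A.min' hne : ℕ) ≤ (A.max' hne : ℕ) from hle)]
    exact_mod_cast hc
  refine hc'.trans ?_
  have : (((A.max' hne : ℕ) : ℝ) - ((A.min' hne : ℕ) : ℝ)) ≤ 1 / h := by
    rw [le_div_iff₀ hh]
    linarith
  linarith

theorem sum_eq_sum_update {ι κ : Type*} [Fintype ι] [DecidableEq ι] [Fintype κ] (i : ι)
    (f : (ι → κ) → ℝ) :
    ∑ u, ∑ σ, f (Function.update u i σ) = Fintype.card κ * ∑ u, f u := by
  have hE : Function.Involutive fun p : (ι → κ) × κ => (Function.update p.1 i p.2, p.1 i) :=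
    fun p => by simp
  have h1 : ∑ p : (ι → κ) × κ, f (Function.update p.1 i p.2) = ∑ p : (ι → κ) × κ, f p.1 :=
    Equiv.sum_comp (Function.Involutive.toPerm _ hE) (fun p => f p.1)
  rw [Fintype.sum_prod_type, Fintype.sum_prod_type] at h1
  rw [h1]
  simp [Finset.mul_sum]

/-- The bound on the probability that the walk is at a given site, `k` steps after a time up to
which the configuration is known. -/
noncomputable def predictability (k : ℕ) : ℝ := 5 * (2 / 3) ^ (Nat.log 2 (k + 1) - 1)

/-- Some block of scale `j`, with `2 ^ j` comparable to `r - t`, lies entirely in `[t, r)`. With all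
other variables frozen, its variable alone spreads the position at time `r` over `L` points with
spacing `(3 / 2) ^ j / (4 L)`. -/
theorem sum_walk_override_eq_le {t r : ℕ} (htr : t < r) (hr : r ≤ L) (w : Config L) (m : ℕ) :
    ∑ u, (if walk (override t w u) r = m then (1 : ℝ) else 0) ≤
      Fintype.card (Config L) * predictability (r - t) := by
  have hL : 0 < L := by omega
  set j := Nat.log 2 (r - t + 1) - 1 with hj
  have hlog : 1 ≤ Nat.log 2 (r - t + 1) := Nat.log_pos one_lt_two (by omega)
  have hpow : 2 ^ (j + 1) ≤ r - t + 1 := by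
    rw [hj, Nat.sub_add_cancel hlog]
    exact Nat.pow_log_le_self 2 (by omega)
  have hP : 0 < 2 ^ j := by positivity
  rw [pow_succ] at hpow
  -- Rounding `t / 2 ^ j` up gives the first block starting at or after `t`; it ends by `t + 2 ^ (j
  -- + 1) - 1 ≤ r`.
  set b := (t + 2 ^ j - 1) / 2 ^ j with hb
  have hb1 : b * 2 ^ j ≤ t + 2 ^ j - 1 := Nat.div_mul_le_self _ _
  have hb2 : t + 2 ^ j - 1 < (b + 1) * 2 ^ j := by
    rw [mul_comm]; exact Nat.lt_mul_div_succ _ hP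
  have hb3 : (b + 1) * 2 ^ j = b * 2 ^ j + 2 ^ j := by ring
  have hjL : j < L := by
    have : j < 2 ^ j := Nat.lt_two_pow_self
    omega
  have hbL : b < L := by
    have : b + 1 ≤ (b + 1) * 2 ^ j := Nat.le_mul_of_pos_right _ hP
    omega
  have hLr : (0 : ℝ) < L := by exact_mod_cast hL
  let i : Fin L × Fin L := (⟨j, hjL⟩, ⟨b, hbL⟩)
  let z : Fin L := ⟨0, hL⟩
  have hov : ∀ (u : Config L) (σ : Fin L),
      override t w (Function.update u i σ) = Function.update (override t w u) i σ := by
    intro u σ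
    funext x
    by_cases hx : x = i
    · subst hx
      have : ¬ b * 2 ^ j < t := by omega
      simp [override, i, this]
    · simp [override, Function.update_of_ne hx]
  have hinner : ∀ u : Config L,
      ∑ σ, (if walk (override t w (Function.update u i σ)) r = m then (1 : ℝ) else 0) ≤
        L * predictability (r - t) := by
    intro u
    have hh : (0 : ℝ) < 1 / 4 * (3 / 2) ^ j / L := by positivity
    have hcard := card_floor_eq_le (L := L)
      (position_nonneg (Function.update (override t w u) i z) r) hh m
    have hw : ∀ σ : Fin L, walk (override t w (Function.update u i σ)) r =
        ⌊position (Function.update (override t w u) i z) r +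
          1 / 4 * (3 / 2) ^ j / L * (σ : ℕ)⌋₊ := by
      intro σ
      rw [hov, walk, position_update _ i σ z rfl (by simp only [i]; omega)]
      congr 1
      simp only [i]
      ring
    simp_rw [hw]
    rw [Finset.sum_boole]
    refine hcard.trans ?_
    have e1 : 1 / (1 / 4 * (3 / 2 : ℝ) ^ j / L) = L * (4 * (2 / 3) ^ j) := by
      rw [show (2 / 3 : ℝ) = (3 / 2)⁻¹ by norm_num, inv_pow]
      field_simp
    -- This absorbs the additive `1` of `card_floor_eq_le`, raising the constant from `4` to `5`.
    have e2 : (1 : ℝ) ≤ L * (2 / 3) ^ j := by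
      have h1 : ((2 : ℝ) ^ j) ≤ L := by
        have : 2 ^ j ≤ L := by omega
        exact_mod_cast this
      calc (1 : ℝ) ≤ (4 / 3) ^ j := one_le_pow₀ (by norm_num)
        _ = 2 ^ j * (2 / 3) ^ j := by rw [← mul_pow]; norm_num
        _ ≤ L * (2 / 3) ^ j := mul_le_mul_of_nonneg_right h1 (by positivity)
    rw [e1, predictability, ← hj]
    linarith
  have htot := sum_eq_sum_update i
    (fun u : Config L => if walk (override t w u) r = m then (1 : ℝ) else 0)
  have h2 := Finset.sum_le_sum fun u (_ : u ∈ (Finset.univ : Finset (Config L))) => hinner u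
  rw [htot, Finset.sum_const, nsmul_eq_mul, Finset.card_univ, Fintype.card_fin] at h2
  refine le_of_mul_le_mul_left (h2.trans (le_of_eq ?_)) hLr
  ring

/-- The dyadic shell with exponent `J` has `2 * 2 ^ J` terms, each `25 * (4 / 9) ^ J`, and `50 * ∑
(8 / 9) ^ J = 450`. Without the square the shells would grow like `(4 / 3) ^ J`, hence the need for
two transverse coordinates. -/
theorem sum_predictability_sq_le (n : ℕ) :
    ∑ k ∈ Finset.Icc 1 n, predictability k ^ 2 ≤ 450 := by
  have dyadic : ∀ J : ℕ, ∑ m ∈ Finset.Ico 2 (2 ^ (J + 1)),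
      ((4 / 9 : ℝ)) ^ (Nat.log 2 m - 1) = 18 * (1 - (8 / 9) ^ J) := by
    intro J
    induction J with
    | zero => simp
    | succ J ih =>
      have h2 : 2 ≤ 2 ^ (J + 1) := by
        calc 2 = 2 ^ 1 := rfl
          _ ≤ 2 ^ (J + 1) := Nat.pow_le_pow_right (by norm_num) (by omega)
      have h3 : 2 ^ (J + 1) ≤ 2 ^ (J + 1 + 1) := Nat.pow_le_pow_right (by norm_num) (by omega)
      rw [← Finset.sum_Ico_consecutive _ h2 h3, ih]
      have : ∀ m ∈ Finset.Ico (2 ^ (J + 1)) (2 ^ (J + 1 + 1)),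
          ((4 / 9 : ℝ)) ^ (Nat.log 2 m - 1) = (4 / 9) ^ J := by
        intro m hm
        rw [Finset.mem_Ico] at hm
        rw [(Nat.log_eq_iff (Or.inl (by omega))).2 hm, Nat.add_sub_cancel]
      rw [Finset.sum_congr rfl this, Finset.sum_const, Nat.card_Ico, nsmul_eq_mul,
        show 2 ^ (J + 1 + 1) - 2 ^ (J + 1) = 2 * 2 ^ J by rw [pow_succ, pow_succ]; omega]
      push_cast
      have h4 : (8 / 9 : ℝ) ^ J = 2 ^ J * (4 / 9) ^ J := by rw [← mul_pow]; norm_num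
      rw [pow_succ (8 / 9 : ℝ), h4]
      ring
  have hsq : ∀ k, predictability k ^ 2 = 25 * (4 / 9 : ℝ) ^ (Nat.log 2 (k + 1) - 1) := by
    intro k
    rw [predictability, mul_pow, ← pow_mul, mul_comm _ 2, pow_mul]
    norm_num
  simp_rw [hsq]
  rw [← Finset.mul_sum]
  have himg : ∑ k ∈ Finset.Icc 1 n, (4 / 9 : ℝ) ^ (Nat.log 2 (k + 1) - 1) ≤
      ∑ m ∈ Finset.Ico 2 (2 ^ (n + 1 + 1)), (4 / 9 : ℝ) ^ (Nat.log 2 m - 1) := by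
    rw [← Finset.sum_image (s := Finset.Icc 1 n) (g := fun k => k + 1)
      (f := fun m => (4 / 9 : ℝ) ^ (Nat.log 2 m - 1)) (fun a _ b _ hab => by simpa using hab)]
    refine Finset.sum_le_sum_of_subset_of_nonneg ?_ fun _ _ _ => by positivity
    intro m hm
    simp only [Finset.mem_image, Finset.mem_Icc, Finset.mem_Ico] at hm ⊢
    obtain ⟨k, hk, rfl⟩ := hm
    have : n + 1 + 1 < 2 ^ (n + 1 + 1) := Nat.lt_two_pow_self
    omega
  rw [dyadic] at himg
  have : (0 : ℝ) ≤ (8 / 9) ^ (n + 1) := by positivity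
  linarith

/-! ### Collisions of two independent planar walks -/

/-- The data of two planar walks. -/
abbrev TwoWalks (L : ℕ) : Type := (Config L × Config L) × (Config L × Config L)

/-- Two planar walks are at the same site at time `r`. -/
def Collide (u v : Config L × Config L) (r : ℕ) : Prop :=
  walk u.1 r = walk v.1 r ∧ walk u.2 r = walk v.2 r

-- The two coordinates are independent, so the count factorises. In each factor one walk is frozen
-- and the other must hit its site.
open Classical in
theorem sum_collide_le {t r : ℕ} (htr : t < r) (hr : r ≤ L) (w₁ w₂ w₃ w₄ : Config L) :
    ∑ u : TwoWalks L, (if Collide (override t w₁ u.1.1, override t w₂ u.1.2)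
      (override t w₃ u.2.1, override t w₄ u.2.2) r then (1 : ℝ) else 0) ≤
      Fintype.card (TwoWalks L) * predictability (r - t) ^ 2 := by
  have hp : 0 ≤ predictability (r - t) := by unfold predictability; positivity
  set N : ℝ := (Fintype.card (Config L) : ℝ) with hNdef
  have hN : 0 ≤ N := Nat.cast_nonneg _
  have hone : ∀ w w' : Config L, ∑ v : Config L, ∑ u : Config L,
      (if walk (override t w u) r = walk (override t w' v) r then (1 : ℝ) else 0) ≤
      N * (N * predictability (r - t)) := by
    intro w w'
    refine (Finset.sum_le_sum fun v _ => sum_walk_override_eq_le htr hr w _).trans ?_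
    simp [N]
  have hcard : (Fintype.card (TwoWalks L) : ℝ) = N * N * (N * N) := by
    simp only [TwoWalks, Fintype.card_prod, Nat.cast_mul, N]
  have hprod : ∑ u : TwoWalks L, (if Collide (override t w₁ u.1.1, override t w₂ u.1.2)
      (override t w₃ u.2.1, override t w₄ u.2.2) r then (1 : ℝ) else 0) =
      (∑ v : Config L, ∑ u : Config L,
        (if walk (override t w₁ u) r = walk (override t w₃ v) r then (1 : ℝ) else 0)) *
      (∑ v : Config L, ∑ u : Config L,
        (if walk (override t w₂ u) r = walk (override t w₄ v) r then (1 : ℝ) else 0)) := by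
    rw [Finset.sum_comm, Finset.sum_comm (f := fun v u =>
      if walk (override t w₂ u) r = walk (override t w₄ v) r then (1 : ℝ) else 0)]
    rw [← Fintype.sum_prod_type', ← Fintype.sum_prod_type', Finset.sum_mul_sum,
      ← Fintype.sum_prod_type']
    refine Fintype.sum_equiv (Equiv.prodProdProdComm _ _ _ _) _ _ fun u => ?_
    by_cases h1 : walk (override t w₁ u.1.1) r = walk (override t w₃ u.2.1) r <;>
      by_cases h2 : walk (override t w₂ u.1.2) r = walk (override t w₄ u.2.2) r <;>
      simp [Collide, h1, h2]
  rw [hprod, hcard]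
  calc _ ≤ (N * (N * predictability (r - t))) * (N * (N * predictability (r - t))) :=
        mul_le_mul (hone _ _) (hone _ _)
          (Finset.sum_nonneg fun _ _ => Finset.sum_nonneg fun _ _ => by split_ifs <;> simp)
          (by positivity)
    _ = _ := by ring

open Classical in
theorem sum_pow_card_collide_le {n : ℕ} (hn : n ≤ L) {q g : ℝ} (hq : 1 ≤ q) (hg0 : 0 ≤ g)
    (hg : 1 + (q - 1) * (450 * g) ≤ g) :
    ∑ u : Config L × Config L, ∑ v : Config L × Config L,
      q ^ ((Finset.Ioc 0 n).filter fun r => Collide u v r).card ≤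
      (Fintype.card (Config L × Config L) : ℝ) ^ 2 * g := by
  let ov : ℕ → TwoWalks L → TwoWalks L → TwoWalks L := fun t w u =>
    ((override t w.1.1 u.1.1, override t w.1.2 u.1.2),
      (override t w.2.1 u.2.1, override t w.2.2 u.2.2))
  have h := sum_pow_card_collisions_le ov
    (fun s w u => by simp only [ov, override_override_swap])
    (fun s t hst w u u' => by simp only [ov, override_override hst])
    (fun r u => Collide u.1 u.2 r)
    (fun s r hrs w u => by simp only [ov, Collide, walk_override hrs])
    (fun k => predictability k ^ 2) (fun k => sq_nonneg _) n
    (fun t r htr hrn w => sum_collide_le htr (hrn.trans hn) _ _ _ _)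
    hq (sum_predictability_sq_le n) hg0 hg 0 (Nat.zero_le n)
  rcases isEmpty_or_nonempty (TwoWalks L) with hE | ⟨⟨w⟩⟩
  · have : IsEmpty (Config L × Config L) := ⟨fun u => hE.elim (u, u)⟩
    simp
  · have h1 := h w
    simp only [ov, override_zero] at h1
    rw [Fintype.sum_prod_type, Fintype.card_prod, Nat.cast_mul, ← sq] at h1
    exact h1


/-! ### Second moment of an average of path observables -/

section SecondMoment

variable {d : ℕ} {Λ : Finset (Fin d → ℤ)}

open Classical in
theorem integral_cos_sum_mem (β : ℝ) (S : Finset (Edge Λ)) :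
    ∫ ω, Real.cos (∑ e ∈ S, ω e) ∂(disorderLaw β Λ) = edgeMean β ^ S.card := by
  have h := integral_cos_sum β (fun e : Edge Λ => if e ∈ S then (1 : ℝ) else 0)
  have h1 : ∀ ω : Edge Λ → ℝ, ∑ e, (if e ∈ S then (1 : ℝ) else 0) * ω e = ∑ e ∈ S, ω e := by
    intro ω
    simp [ite_mul, Finset.sum_ite_mem]
  simp_rw [h1] at h
  rw [h, ← Finset.prod_const, ← Finset.prod_subset (Finset.subset_univ S)]
  · exact Finset.prod_congr rfl fun e he => by simp [he, edgeMean]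
  · intro e _ he
    simp [he]

-- Edge by edge: a common edge cancels from the phase and leaves `m⁻²`, while an edge in just one
-- set contributes `m⁻¹ * m = 1`.
open Classical in
theorem integral_cos_sum_sub_sum (β : ℝ) (hm : 0 < edgeMean β) (S T : Finset (Edge Λ)) :
    (edgeMean β)⁻¹ ^ S.card * (edgeMean β)⁻¹ ^ T.card *
      ∫ ω, Real.cos (∑ e ∈ S, ω e - ∑ e ∈ T, ω e) ∂(disorderLaw β Λ) =
      ((edgeMean β)⁻¹ ^ 2) ^ (S ∩ T).card := by
  have h := integral_cos_sum β
    (fun e : Edge Λ => (if e ∈ S then (1 : ℝ) else 0) - if e ∈ T then (1 : ℝ) else 0)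
  have h1 : ∀ ω : Edge Λ → ℝ,
      ∑ e, ((if e ∈ S then (1 : ℝ) else 0) - if e ∈ T then (1 : ℝ) else 0) * ω e =
        ∑ e ∈ S, ω e - ∑ e ∈ T, ω e := by
    intro ω
    simp [sub_mul, ite_mul, Finset.sum_ite_mem]
  simp_rw [h1] at h
  have hpow : ∀ (x : ℝ) (U : Finset (Edge Λ)), x ^ U.card = ∏ e, if e ∈ U then x else 1 := by
    intro x U
    simp [Finset.prod_ite_mem]
  rw [h, hpow, hpow, hpow, ← Finset.prod_mul_distrib, ← Finset.prod_mul_distrib]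
  refine Finset.prod_congr rfl fun e _ => ?_
  by_cases hS : e ∈ S <;> by_cases hT : e ∈ T
  · simp [hS, hT, sq]
  · have : ∫ w, Real.cos w ∂(edgeLaw β) = edgeMean β := rfl
    simp [hS, hT, this, hm.ne']
  · have : ∫ w, Real.cos w ∂(edgeLaw β) = edgeMean β := rfl
    simp [hS, hT, this, hm.ne']
  · simp [hS, hT]

open Classical in
/-- The magnetisation on the Nishimori line is bounded below by means of any family of edge sets
whose flux goes from the origin to the boundary. -/
theorem one_le_average_mul_nishimoriExp {κ : Type*} [Fintype κ] [Nonempty κ] (β : ℝ)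
    (hm : 0 < edgeMean β) (B : Finset (Fin d → ℤ)) (o : Λ) (E : κ → Finset (Edge Λ))
    (hE : ∀ u (φ : Λ → ℝ), (∀ i : Λ, (i : Fin d → ℤ) ∈ B → φ i = 0) →
      ∑ e ∈ E u, grad φ e = φ o) :
    1 ≤ ((Fintype.card κ : ℝ)⁻¹ ^ 2 *
        ∑ u, ∑ v, ((edgeMean β)⁻¹ ^ 2) ^ (E u ∩ E v).card) *
      nishimoriExp β Λ B (fun θ => Real.cos (θ o)) := by
  set m := edgeMean β with hmdef
  set N : ℝ := (Fintype.card κ : ℝ) with hN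
  have hN0 : 0 < N := by rw [hN]; exact_mod_cast Fintype.card_pos
  have hmi : 0 < m⁻¹ := inv_pos.2 hm
  have bound : ∀ f : ℝ → ℝ, (∀ x, |f x| ≤ 1) → ∀ ω : Edge Λ → ℝ,
      |N⁻¹ * ∑ u, m⁻¹ ^ (E u).card * f (∑ e ∈ E u, ω e)| ≤ N⁻¹ * ∑ u, m⁻¹ ^ (E u).card := by
    intro f hf ω
    rw [abs_mul, abs_of_pos (inv_pos.2 hN0)]
    refine mul_le_mul_of_nonneg_left ((Finset.abs_sum_le_sum_abs _ _).trans
      (Finset.sum_le_sum fun u _ => ?_)) (inv_pos.2 hN0).le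
    rw [abs_mul, abs_of_pos (pow_pos hmi _)]
    exact mul_le_of_le_one_right (pow_pos hmi _).le (hf _)
  have shift : ∀ (ω : Edge Λ → ℝ) (φ : Λ → ℝ),
      (∀ i : Λ, (i : Fin d → ℤ) ∈ B → φ i = 0) → ∀ u,
      ∑ e ∈ E u, (ω e + grad φ e) = ∑ e ∈ E u, ω e + φ o := by
    intro ω φ hφ u
    rw [Finset.sum_add_distrib, hE u φ hφ]
  have per : ∀ (ω : Edge Λ → ℝ) (k : Edge Λ → ℤ) u,
      ∑ e ∈ E u, (ω e + k e * (2 * Real.pi)) =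
        ∑ e ∈ E u, ω e + ((∑ e ∈ E u, k e : ℤ) : ℝ) * (2 * Real.pi) := by
    intro ω k u
    rw [Finset.sum_add_distrib, ← Finset.sum_mul]
    push_cast
    rfl
  have hcint : ∀ f : (Edge Λ → ℝ) → ℝ, Continuous f →
      Integrable (fun ω => Real.cos (f ω)) (disorderLaw β Λ) := fun f hf =>
    Integrable.of_bound (Real.continuous_cos.comp hf).aestronglyMeasurable 1
      (Filter.Eventually.of_forall fun ω => Real.abs_cos_le_one _)
  -- The factor `m⁻¹ ^ (E u).card` normalises each phase to mean one; `hE` makes all of them rotate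
  -- by the same angle `φ o`.
  have main := one_le_second_moment_mul_nishimoriExp β B o
    (X := fun ω => N⁻¹ * ∑ u, m⁻¹ ^ (E u).card * Real.cos (∑ e ∈ E u, ω e))
    (Y := fun ω => N⁻¹ * ∑ u, m⁻¹ ^ (E u).card * Real.sin (∑ e ∈ E u, ω e))
    (Continuous.measurable (by fun_prop)) (Continuous.measurable (by fun_prop))
    (bound Real.cos Real.abs_cos_le_one) (bound Real.sin Real.abs_sin_le_one)
    (fun ω k => by simp only [per, Real.cos_add_int_mul_two_pi])
    (fun ω k => by simp only [per, Real.sin_add_int_mul_two_pi])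
    (fun ω φ hφ => by
      simp only [shift ω φ hφ, Real.cos_add, mul_sub, Finset.sum_sub_distrib, Finset.mul_sum,
        Finset.sum_mul, mul_assoc])
    (fun ω φ hφ => by
      simp only [shift ω φ hφ, Real.sin_add, mul_add, Finset.sum_add_distrib, Finset.mul_sum,
        Finset.sum_mul, mul_assoc])
    (by
      rw [integral_const_mul, integral_finsetSum _ fun u _ => (hcint _ (by fun_prop)).const_mul _]
      simp_rw [integral_const_mul, integral_cos_sum_mem, ← hmdef, ← mul_pow,
        inv_mul_cancel₀ hm.ne', one_pow]
      simp only [Finset.sum_const, Finset.card_univ, nsmul_eq_mul, mul_one]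
      exact inv_mul_cancel₀ hN0.ne')
  refine main.trans (le_of_eq ?_)
  congr 1
  have hsq : ∀ ω : Edge Λ → ℝ,
      (N⁻¹ * ∑ u, m⁻¹ ^ (E u).card * Real.cos (∑ e ∈ E u, ω e)) ^ 2 +
        (N⁻¹ * ∑ u, m⁻¹ ^ (E u).card * Real.sin (∑ e ∈ E u, ω e)) ^ 2 =
      N⁻¹ ^ 2 * ∑ u, ∑ v, m⁻¹ ^ (E u).card * m⁻¹ ^ (E v).card *
        Real.cos (∑ e ∈ E u, ω e - ∑ e ∈ E v, ω e) := by
    intro ω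
    rw [mul_pow, mul_pow, ← mul_add, sq (∑ u, _), sq (∑ u, _), Finset.sum_mul_sum,
      Finset.sum_mul_sum, ← Finset.sum_add_distrib]
    congr 1
    refine Finset.sum_congr rfl fun u _ => ?_
    rw [← Finset.sum_add_distrib]
    refine Finset.sum_congr rfl fun v _ => ?_
    rw [Real.cos_sub]
    ring
  simp_rw [hsq]
  rw [integral_const_mul, integral_finsetSum _ fun u _ => integrable_finsetSum _ fun v _ =>
    (hcint _ (by fun_prop)).const_mul _]
  congr 1
  refine Finset.sum_congr rfl fun u _ => ?_
  rw [integral_finsetSum _ fun v _ => (hcint _ (by fun_prop)).const_mul _]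
  refine Finset.sum_congr rfl fun v _ => ?_
  rw [integral_const_mul]
  exact integral_cos_sum_sub_sum β hm (E u) (E v)

end SecondMoment

/-! ### Monotone lattice paths -/

variable {d : ℕ}

/-- The lattice site with the given first three coordinates, the others being zero. -/
def site (d : ℕ) (a b c : ℤ) : Fin d → ℤ := fun i =>
  if (i : ℕ) = 0 then a else if (i : ℕ) = 1 then b else if (i : ℕ) = 2 then c else 0

theorem site_inj (hd : 3 ≤ d) {a b c a' b' c' : ℤ} (h : site d a b c = site d a' b' c') :
    a = a' ∧ b = b' ∧ c = c' := by
  have h0 := congrFun h ⟨0, by omega⟩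
  have h1 := congrFun h ⟨1, by omega⟩
  have h2 := congrFun h ⟨2, by omega⟩
  simp [site] at h0 h1 h2
  exact ⟨h0, h1, h2⟩

/-- The lattice path following a pair of walks: in each unit of time the first, second and third
coordinates move in turn. -/
noncomputable def path (d : ℕ) (u : Config L × Config L) (k : ℕ) : Fin d → ℤ :=
  site d (walk u.1 ((k + 2) / 3) : ℕ) (walk u.2 ((k + 1) / 3) : ℕ) ((k / 3 : ℕ) : ℤ)

theorem isPos_site (hd : 3 ≤ d) (a b c : ℤ) : IsPos (site d a b c) (site d (a + 1) b c) ∧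
    IsPos (site d a b c) (site d a (b + 1) c) ∧ IsPos (site d a b c) (site d a b (c + 1)) := by
  refine ⟨⟨⟨0, by omega⟩, ?_⟩, ⟨⟨1, by omega⟩, ?_⟩, ⟨⟨2, by omega⟩, ?_⟩⟩ <;>
  · funext i
    simp only [site, Pi.add_apply, Pi.single_apply, Fin.ext_iff]
    split_ifs <;> omega

theorem path_step (hd : 3 ≤ d) (u : Config L × Config L) (k : ℕ) :
    path d u (k + 1) = path d u k ∨ IsPos (path d u k) (path d u (k + 1)) := by
  obtain ⟨t, ht⟩ : ∃ t, k = 3 * t ∨ k = 3 * t + 1 ∨ k = 3 * t + 2 := ⟨k / 3, by omega⟩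
  unfold path
  rcases ht with rfl | rfl | rfl
  · rw [show (3 * t + 1 + 2) / 3 = t + 1 by omega, show (3 * t + 1 + 1) / 3 = t by omega,
      show (3 * t + 1) / 3 = t by omega, show 3 * t / 3 = t by omega]
    rcases walk_succ u.1 t with h | h
    · rw [h]; exact Or.inl rfl
    · rw [h]; push_cast; exact Or.inr (isPos_site hd _ _ _).1
  · rw [show (3 * t + 1 + 1 + 2) / 3 = t + 1 by omega,
      show (3 * t + 1 + 1 + 1) / 3 = t + 1 by omega,
      show (3 * t + 1 + 1) / 3 = t by omega, show (3 * t + 1) / 3 = t by omega]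
    rcases walk_succ u.2 t with h | h
    · rw [h]; exact Or.inl rfl
    · rw [h]; push_cast; exact Or.inr (isPos_site hd _ _ _).2.1
  · rw [show (3 * t + 2 + 1 + 2) / 3 = t + 1 by omega,
      show (3 * t + 2 + 1 + 1) / 3 = t + 1 by omega,
      show (3 * t + 2 + 1) / 3 = t + 1 by omega, show (3 * t + 2) / 3 = t by omega]
    push_cast
    exact Or.inr (isPos_site hd _ _ _).2.2

/-- The third coordinate at both endpoints leaves only the confusion of steps `3t` and `3t + 1`. The
first coordinate may move only in the former, and a common edge would force that step to be idle. -/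
theorem path_step_inj (hd : 3 ≤ d) {u v : Config L × Config L} {k l : ℕ}
    (h : path d u k = path d v l) (h' : path d u (k + 1) = path d v (l + 1))
    (hne : path d u (k + 1) ≠ path d u k) : k = l := by
  have e1 := site_inj hd h
  have e2 := site_inj hd h'
  have a1 : k / 3 = l / 3 := by exact_mod_cast e1.2.2
  have a2 : (k + 1) / 3 = (l + 1) / 3 := by exact_mod_cast e2.2.2
  have key : ∀ (x y : Config L × Config L) (t : ℕ), path d x (3 * t) = path d y (3 * t + 1) →
      path d x (3 * t + 1) = path d y (3 * t + 1 + 1) →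
      path d x (3 * t + 1) = path d x (3 * t) := by
    intro x y t hx hx'
    have f1 := (site_inj hd hx).1
    have f2 := (site_inj hd hx').1
    rw [show (3 * t + 1 + 2) / 3 = t + 1 by omega, show (3 * t + 2) / 3 = t by omega] at f1
    rw [show (3 * t + 1 + 2) / 3 = t + 1 by omega,
      show (3 * t + 1 + 1 + 2) / 3 = t + 1 by omega] at f2
    unfold path
    rw [show (3 * t + 1 + 2) / 3 = t + 1 by omega, show (3 * t + 1 + 1) / 3 = t by omega,
      show (3 * t + 1) / 3 = t by omega, show 3 * t / 3 = t by omega, f2, f1]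
  by_contra hkl
  have hcases : (k = 3 * (k / 3) ∧ l = 3 * (k / 3) + 1) ∨
      (k = 3 * (k / 3) + 1 ∧ l = 3 * (k / 3)) := by omega
  generalize k / 3 = t at hcases
  rcases hcases with ⟨rfl, rfl⟩ | ⟨rfl, rfl⟩
  · exact hne (key u v t h h')
  · have := key v u t h.symm h'.symm
    exact hne (by rw [h, h', this])

/-- The walk time `(k + 2) / 3` is read by the first coordinate at `k` and by the second at `k + 1`,
so both endpoints are needed. -/
theorem collide_of_path_eq (hd : 3 ≤ d) {u v : Config L × Config L} {k : ℕ}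
    (h : path d u k = path d v k) (h' : path d u (k + 1) = path d v (k + 1)) :
    Collide u v ((k + 2) / 3) := by
  have e1 := site_inj hd h
  have e2 := site_inj hd h'
  refine ⟨by exact_mod_cast e1.1, ?_⟩
  have : ((k + 1 + 1) / 3 : ℕ) = (k + 2) / 3 := rfl
  rw [← this]
  exact_mod_cast e2.2.1

theorem path_mem_box (u : Config L × Config L) {n k : ℕ} (hk : k ≤ 3 * n) :
    path d u k ∈ box d n := by
  have h1 := walk_le u.1 ((k + 2) / 3)
  have h2 := walk_le u.2 ((k + 1) / 3)
  rw [box, Finset.mem_Icc]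
  constructor <;> intro i <;> simp only [path, site] <;> split_ifs <;> omega

theorem path_zero (u : Config L × Config L) : path d u 0 = 0 := by
  funext i
  simp [path, site, walk_zero]

theorem path_end_mem_innerBoundary (hd : 3 ≤ d) (u : Config L × Config L) (n : ℕ) :
    path d u (3 * n) ∈ innerBoundary (box d n) := by
  simp only [innerBoundary, Finset.mem_filter]
  refine ⟨path_mem_box u le_rfl, path d u (3 * n) + Pi.single ⟨2, by omega⟩ 1, ?_,
    adj_iff.2 (Or.inl ⟨_, rfl⟩)⟩
  intro h
  rw [box, Finset.mem_Icc] at h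
  have := h.2 ⟨2, by omega⟩
  simp [path, site] at this

open Classical in
/-- The edges of the box traversed by the path. -/
noncomputable def pathEdges (d n : ℕ) (u : Config L × Config L) : Finset (Edge (box d n)) :=
  Finset.univ.filter fun e => ∃ k < 3 * n,
    (e.1.1 : Fin d → ℤ) = path d u k ∧ (e.1.2 : Fin d → ℤ) = path d u (k + 1)

theorem IsPos.ne {i j : Fin d → ℤ} (h : IsPos i j) : j ≠ i := by
  rintro rfl
  exact h.not_symm h

/-- The sum telescopes along the path. Idle steps contribute nothing, and `path_step_inj` ensures
that each edge is traversed once. -/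
theorem sum_grad_pathEdges (hd : 3 ≤ d) (n : ℕ) (u : Config L × Config L)
    (φ : box d n → ℝ) (hend : ∀ i : box d n, (i : Fin d → ℤ) ∈ innerBoundary (box d n) → φ i = 0) :
    ∑ e ∈ pathEdges d n u, grad φ e = φ (origin d n) := by
  classical
  let ψ : (Fin d → ℤ) → ℝ := fun x => if h : x ∈ box d n then φ ⟨x, h⟩ else 0
  have hψ : ∀ x : box d n, ψ x = φ x := fun x => by simp [ψ]
  have htel := Finset.sum_range_sub' (fun k => ψ (path d u k)) (3 * n)
  have h0 : ψ (path d u 0) = φ (origin d n) := by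
    rw [path_zero]; exact hψ (origin d n)
  have h1 : ψ (path d u (3 * n)) = 0 := by
    have hmem := path_mem_box (d := d) u (le_refl (3 * n))
    rw [← hend ⟨_, hmem⟩ (path_end_mem_innerBoundary hd u n)]
    exact hψ ⟨_, hmem⟩
  rw [h0, h1, sub_zero] at htel
  rw [← htel, ← Finset.sum_filter_of_ne (p := fun k => path d u (k + 1) ≠ path d u k)
    (fun k _ hk hEq => hk (by rw [hEq, sub_self]))]
  symm
  have hpos : ∀ k ∈ (Finset.range (3 * n)).filter (fun k => path d u (k + 1) ≠ path d u k),
      IsPos (path d u k) (path d u (k + 1)) := fun k hk =>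
    (path_step hd u k).resolve_left (Finset.mem_filter.1 hk).2
  have hlt : ∀ k ∈ (Finset.range (3 * n)).filter (fun k => path d u (k + 1) ≠ path d u k),
      k < 3 * n := fun k hk => Finset.mem_range.1 (Finset.mem_filter.1 hk).1
  refine Finset.sum_bij (fun k hk => (⟨(⟨path d u k, path_mem_box u (hlt k hk).le⟩,
    ⟨path d u (k + 1), path_mem_box u (hlt k hk)⟩), hpos k hk⟩ : Edge (box d n))) ?_ ?_ ?_ ?_
  · intro k hk
    simp only [pathEdges, Finset.mem_filter, Finset.mem_univ, true_and]
    exact ⟨k, hlt k hk, rfl, rfl⟩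
  · intro k hk l hl hkl
    simp only [Subtype.mk.injEq, Prod.mk.injEq] at hkl
    exact path_step_inj hd hkl.1 hkl.2 (Finset.mem_filter.1 hk).2
  · intro e he
    simp only [pathEdges, Finset.mem_filter, Finset.mem_univ, true_and] at he
    obtain ⟨k, hk, h1, h2⟩ := he
    have hp := e.2
    rw [h1, h2] at hp
    refine ⟨k, Finset.mem_filter.2 ⟨Finset.mem_range.2 hk, hp.ne⟩, ?_⟩
    exact Subtype.ext (Prod.ext (Subtype.ext h1.symm) (Subtype.ext h2.symm))
  · intro k hk
    simp only [grad, ← hψ]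

-- A common edge is crossed by both paths at the same step `k`, which forces a collision at time `(k
-- + 2) / 3`. Each time serves at most three steps; the extra `1` accounts for time `0`.
open Classical in
theorem card_pathEdges_inter_le (hd : 3 ≤ d) (n : ℕ) (u v : Config L × Config L) :
    (pathEdges d n u ∩ pathEdges d n v).card ≤
      3 * (1 + ((Finset.Ioc 0 n).filter fun r => Collide u v r).card) := by
  have hk : ∀ e ∈ pathEdges d n u ∩ pathEdges d n v, ∃ k < 3 * n, Collide u v ((k + 2) / 3) ∧
      (e.1.1 : Fin d → ℤ) = path d u k ∧ (e.1.2 : Fin d → ℤ) = path d u (k + 1) := by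
    intro e he
    simp only [pathEdges, Finset.mem_inter, Finset.mem_filter, Finset.mem_univ, true_and] at he
    obtain ⟨⟨k, hk, h1, h2⟩, l, hl, h3, h4⟩ := he
    have hp := e.2
    rw [h1, h2] at hp
    have hkl := path_step_inj hd (h1.symm.trans h3) (h2.symm.trans h4) hp.ne
    subst hkl
    exact ⟨k, hk, collide_of_path_eq hd (h1.symm.trans h3) (h2.symm.trans h4), h1, h2⟩
  choose! f hf using hk
  set K := (Finset.Ioc 0 n).filter fun r => Collide u v r with hK
  calc (pathEdges d n u ∩ pathEdges d n v).card
      ≤ (Finset.range 3 ×ˢ insert 0 K).card := by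
        refine Finset.card_le_card_of_injOn (fun e => (f e % 3, (f e + 2) / 3)) ?_ ?_
        · intro e he
          obtain ⟨h1, h2, -, -⟩ := hf e he
          simp only [Finset.coe_product, Set.mem_prod, Finset.mem_coe, Finset.mem_range,
            Finset.mem_insert, hK, Finset.mem_filter, Finset.mem_Ioc]
          refine ⟨Nat.mod_lt _ (by norm_num), ?_⟩
          by_cases h0 : (f e + 2) / 3 = 0
          · exact Or.inl h0
          · exact Or.inr ⟨⟨by omega, by omega⟩, h2⟩
        · intro e he e' he' hee
          simp only [Prod.mk.injEq] at hee
          have hff : f e = f e' := by omega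
          obtain ⟨-, -, h1, h2⟩ := hf e he
          obtain ⟨-, -, h3, h4⟩ := hf e' he'
          rw [← hff] at h3 h4
          exact Subtype.ext (Prod.ext (Subtype.ext (h1.trans h3.symm))
            (Subtype.ext (h2.trans h4.symm)))
    _ = 3 * (1 + K.card) := by
        rw [Finset.card_product, Finset.card_range,
          Finset.card_insert_of_notMem (by simp [hK]), add_comm]


/-! ### The uniform bound and the conclusion -/

/-- A quantitative lower bound on the magnetisation on the Nishimori line, uniform in the box. -/
theorem one_sub_le_nishimoriExp {d : ℕ} (hd : 3 ≤ d) {β x : ℝ} (hx : 1 - edgeMean β ≤ x)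
    (hx0 : 0 ≤ x) (hx1 : x ≤ 1 / 6000) (n : ℕ) (B : Finset (Fin d → ℤ))
    (hB : innerBoundary (box d n) ⊆ B) :
    1 - 5412 * x ≤ nishimoriExp β (box d n) B (fun θ => Real.cos (θ (origin d n))) := by
  classical
  set m := edgeMean β with hmdef
  have hm : 0 < m := by linarith
  have hm1 : m ≤ 1 := edgeMean_le_one β
  -- A factor `m⁻²` per common edge, and at most three common edges per collision time.
  set q : ℝ := (m⁻¹ ^ 2) ^ 3 with hqdef
  have hmi : 1 ≤ m⁻¹ := (one_le_inv₀ hm).2 hm1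
  have hmi2 : 1 ≤ m⁻¹ ^ 2 := one_le_pow₀ hmi
  have hq : 1 ≤ q := one_le_pow₀ hmi2
  have hqx : q ≤ 1 + 12 * x := by
    have h6 : q = (m ^ 6)⁻¹ := by rw [hqdef, ← pow_mul, inv_pow]
    have hb : 1 - 6 * x ≤ m ^ 6 := by
      have h1 := one_add_mul_le_pow (show (-2 : ℝ) ≤ -x by linarith) 6
      have h2 : (1 + -x) ^ 6 ≤ m ^ 6 := pow_le_pow_left₀ (by linarith) (by linarith) 6
      push_cast at h1
      linarith
    rw [h6, inv_le_iff_one_le_mul₀ (by positivity)]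
    have h3 : (1 + 12 * x) * (1 - 6 * x) ≤ (1 + 12 * x) * m ^ 6 :=
      mul_le_mul_of_nonneg_left hb (by linarith)
    nlinarith
  have hden : 0 < 1 - 450 * (q - 1) := by linarith
  -- The solution of `1 + (q - 1) * (450 * g) = g`; it is positive because `450 * (q - 1) ≤ 5400 * x
  -- < 1`.
  set g : ℝ := (1 - 450 * (q - 1))⁻¹
  have hg0 : 0 < g := inv_pos.2 hden
  have hgm : g * (1 - 450 * (q - 1)) = 1 := inv_mul_cancel₀ hden.ne'
  have hcoll := sum_pow_card_collide_le (L := n + 1) (n := n) (Nat.le_succ n) hq hg0.le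
    (by linarith)
  have : Nonempty (Config (n + 1) × Config (n + 1)) := ⟨(fun _ => 0, fun _ => 0)⟩
  have hmain := one_le_average_mul_nishimoriExp (κ := Config (n + 1) × Config (n + 1)) β hm B
    (origin d n) (pathEdges d n)
    (fun u φ hφ => sum_grad_pathEdges hd n u φ fun i hi => hφ i (hB hi))
  rw [← hmdef] at hmain
  set N : ℝ := (Fintype.card (Config (n + 1) × Config (n + 1)) : ℝ) with hNdef
  have hN0 : 0 < N := by rw [hNdef]; exact_mod_cast Fintype.card_pos
  set V : ℝ := N⁻¹ ^ 2 * ∑ u : Config (n + 1) × Config (n + 1),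
    ∑ v : Config (n + 1) × Config (n + 1), (m⁻¹ ^ 2) ^ (pathEdges d n u ∩ pathEdges d n v).card
  set G := nishimoriExp β (box d n) B (fun θ => Real.cos (θ (origin d n)))
  have hsum : ∑ u : Config (n + 1) × Config (n + 1), ∑ v : Config (n + 1) × Config (n + 1),
      (m⁻¹ ^ 2) ^ (pathEdges d n u ∩ pathEdges d n v).card ≤
      q * (N ^ 2 * g) := by
    refine le_trans ?_ (mul_le_mul_of_nonneg_left hcoll (by linarith))
    rw [Finset.mul_sum]
    refine Finset.sum_le_sum fun u _ => ?_
    rw [Finset.mul_sum]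
    refine Finset.sum_le_sum fun v _ => ?_
    refine (pow_le_pow_right₀ hmi2 (card_pathEdges_inter_le hd n u v)).trans (le_of_eq ?_)
    rw [pow_mul, ← hqdef, pow_add, pow_one]
  have hVle : V ≤ q * g := by
    refine (mul_le_mul_of_nonneg_left hsum (by positivity)).trans (le_of_eq ?_)
    field_simp
  have hV0 : 0 ≤ V := mul_nonneg (by positivity)
    (Finset.sum_nonneg fun _ _ => Finset.sum_nonneg fun _ _ => by positivity)
  have hG : 0 < G := by
    by_contra h
    have := mul_nonpos_of_nonneg_of_nonpos hV0 (not_lt.1 h)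
    linarith
  have hqg : 1 ≤ q * g * G := hmain.trans (mul_le_mul_of_nonneg_right hVle hG.le)
  have h1 : 1 - 450 * (q - 1) ≤ q * G := by
    calc 1 - 450 * (q - 1) ≤ (1 - 450 * (q - 1)) * (q * g * G) :=
          le_mul_of_one_le_right hden.le hqg
      _ = (g * (1 - 450 * (q - 1))) * (q * G) := by ring
      _ = q * G := by rw [hgm, one_mul]
  -- Dividing by `q` costs one more `q - 1`; with `q - 1 ≤ 12 * x` this gives `5412 = 12 * 451`.
  have h2 : q * (1 - 451 * (q - 1)) ≤ q * G := by
    refine le_trans ?_ h1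
    nlinarith [sq_nonneg (q - 1)]
  have h3 := le_of_mul_le_mul_left h2 (by linarith)
  linarith

theorem nishimoriExp_cos_le_one {d : ℕ} (β : ℝ) (Λ B : Finset (Fin d → ℤ)) (o : Λ) :
    nishimoriExp β Λ B (fun θ => Real.cos (θ o)) ≤ 1 := by
  have := norm_integral_le_of_norm_le_const (μ := disorderLaw β Λ)
    (f := fun ω => gibbsExp β Λ B ω fun θ => Real.cos (θ o)) (C := 1)
    (Filter.Eventually.of_forall fun ω => abs_gibbsExp_le β B (by fun_prop)
      (fun θ => Real.abs_cos_le_one _) ω)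
  simp only [probReal_univ, mul_one] at this
  exact (le_abs_self _).trans this

end NishimoriXY

theorem corollary1p8 (d : ℕ) (hd : 3 ≤ d) :
    ∃ βstar a : ℝ, 0 < βstar ∧ 0 < a ∧
      ∀ β : ℝ, βstar ≤ β →
        ∀ B : ℕ → Finset (Fin d → ℤ),
          (∀ n, NishimoriXY.innerBoundary (NishimoriXY.box d n) ⊆ B n) →
          (∀ n, B n ⊆ NishimoriXY.box d n) →
          1 - Real.sqrt (a * Real.log β / β) ≤
            Filter.liminf
              (fun n : ℕ => NishimoriXY.nishimoriExp β (NishimoriXY.box d n) (B n)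
                (fun θ => Real.cos (θ (NishimoriXY.origin d n))))
              Filter.atTop := by
  set C : ℝ := Real.pi * Real.sqrt Real.pi * Real.exp (1 / 2) / 2 with hC
  have hC0 : 0 < C := by have := Real.pi_pos; positivity
  -- The `3` gives `log β ≥ 1`, the `6000 * C` gives `C / β ≤ 1 / 6000`, and `a` is the square of
  -- the constant in the `O(1/β)` bound.
  refine ⟨3 + 6000 * C, (5412 * C) ^ 2, by positivity, by positivity, fun β hβ B hB _ => ?_⟩
  have hβ3 : 3 ≤ β := by linarith
  have hβ0 : 0 < β := by linarith
  have hlog : 1 ≤ Real.log β := by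
    rw [Real.le_log_iff_exp_le hβ0]
    linarith [Real.exp_one_lt_d9]
  have hx1 : C / β ≤ 1 / 6000 := by
    rw [div_le_div_iff₀ hβ0 (by norm_num)]
    linarith
  -- The `O(1/β)` error is weakened to the stated one through `1 / β ≤ 1 ≤ log β`.
  have hbound : 1 - Real.sqrt ((5412 * C) ^ 2 * Real.log β / β) ≤ 1 - 5412 * (C / β) := by
    have : 5412 * (C / β) ≤ Real.sqrt ((5412 * C) ^ 2 * Real.log β / β) := by
      apply Real.le_sqrt_of_sq_le
      have h1 : (5412 * (C / β)) ^ 2 = (5412 * C) ^ 2 / β * (1 / β) := by ring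
      have h2 : (5412 * C) ^ 2 * Real.log β / β = (5412 * C) ^ 2 / β * Real.log β := by ring
      rw [h1, h2]
      refine mul_le_mul_of_nonneg_left ?_ (by positivity)
      exact ((div_le_one hβ0).2 (by linarith)).trans hlog
    linarith
  refine Filter.le_liminf_of_le (Filter.isCoboundedUnder_ge_of_le _ (x := 1) fun n =>
    NishimoriXY.nishimoriExp_cos_le_one β _ _ _) (Filter.Eventually.of_forall fun n => ?_)
  exact hbound.trans (NishimoriXY.one_sub_le_nishimoriExp hd
    (NishimoriXY.one_sub_edgeMean_le (by linarith)) (by positivity) hx1 n (B n) (hB n))
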